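/- Let $R$ be a finite commutative chain ring (a finite commutative local ring whose ideals are totally ordered by inclusion) of odd characteristic, whose maximal ideal $\langle\gamma\rangle$ has nilpotency index $3$ (that is, $\gamma^3=0\neq\gamma^2$). Put $R_3=R$ and $R_2=R/\langle\gamma^2\rangle$, and let $\mathbb F_q=R/\langle\gamma\rangle$ be the residue field, of odd prime power order $q$. Let $N_1,N_2$ be positive integers. An $R_3R_2$-linear code of block-length $(N_1,N_2)$ is an $R$-submodule $C$ of $R_3^{N_1}\oplus R_2^{N_2}$. Its Euclidean dual $C^{\perp_E}$ is the set of all $(c\,|\,d)\in R_3^{N_1}\oplus R_2^{N_2}$ such that $$\sum_{i=1}^{N_1}c_ic_i'+\gamma\sum_{j=1}^{N_2}d_jd_j'=0 \text{ in } R_3\quad\text{for all }(c'\,|\,d')\in C ,$$ where $\gamma d$, for $d\in R_2$, denotes the element $\gamma\tilde d$ of $R_3$, $\tilde d\in R_3$ being any representative of $d$. The code $C$ is Euclidean self-dual if $C=C^{\perp_E}$. Then a Euclidean self-dual $R_3R_2$-linear code of block-length $(N_1,N_2)$ exists if and only if $N_1$ is even and $(-1)^{N_1/2}$ is a square in $\mathbb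 F_q$. Furthermore, when $N_1$ is even and $(-1)^{N_1/2}$ is a square in $\mathbb F_q$, the number of distinct Euclidean self-dual $R_3R_2$-linear codes of block-length $(N_1,N_2)$ equals $$\sum_{k_0=0}^{N_1/2}\ \sum_{\ell_0=0}^{\lfloor N_2/2\rfloor}\sigma_q\!\left(N_1,\tfrac{N_1}{2}\right)\sigma_q(N_2,\ell_0)\begin{bmatrix}N_1/2\\k_0\end{bmatrix}_q q^{\,k_0\left(\frac{N_1}{2}+N_2-1\right)+\frac{\ell_0}{2}\left(N_1-2k_0+\ell_0-1\right)} .$$ Here $$\begin{bmatrix}n\\s\end{bmatrix}_q=\frac{(q^n-1)(q^n-q)\cdots(q^n-q^{s-1})}{(q^s-1)(q^s-q)\cdots(q^s-q^{s-1})}\qquad\text{for } 0\le s\le n$$ is the Gaussian binomial coefficient (equal to $1$ for $s=0$), and the numbers $\sigma_q(n,s)$ are given by $\sigma_q(n,0)=1$, $\sigma_q(n,s)=0$ for $s>\lfloor n/2\rfloor$, and, for $1\le s\le\lfloor n/2\rfloor$, $$\sigma_q(n,s)=\begin{cases}\dfrac{\prod_{i=0}^{s-1}\left(q^{n-1-2i}-1\right)}{\prod_{j=1}^{s}\left(q^j-1\right)}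 & \text{if } n \text{ is odd},\\[3ex] \dfrac{\left(q^{n-s}-\nu q^{\frac n2-s}+\nu q^{\frac n2}-1\right)\prod_{i=1}^{s-1}\left(q^{n-2i}-1\right)}{\prod_{j=1}^{s}\left(q^j-1\right)} & \text{if } n \text{ is even},\end{cases}$$ where $\nu=1$ if $(-1)^{n/2}$ is a square in $\mathbb F_q$ and $\nu=-1$ otherwise. -/

import Mathlib

noncomputable section

namespace MixedCode

/-- A commutative ring is a chain ring when its ideals are totally ordered by inclusion. -/
def IsChainRing (R : Type*) [CommRing R] : Prop :=
  ∀ I J : Ideal R, I ≤ J ∨ J ≤ I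

/-- The ambient `R`-module `R ^ N₁ ⊕ (R / ⟨γ ^ m⟩) ^ N₂`. When the maximal ideal `⟨γ⟩` of `R` has
nilpotency index `m + 1`, its submodules are the mixed-alphabet linear codes of block-length
`(N₁, N₂)`. -/
abbrev Ambient (R : Type*) [CommRing R] (γ : R) (m N₁ N₂ : ℕ) : Type _ :=
  (Fin N₁ → R) × (Fin N₂ → R ⧸ Ideal.span {γ ^ m})

/-- A linear code of block-length `(N₁, N₂)`: an `R`-submodule of the ambient module. -/
abbrev Code (R : Type*) [CommRing R] (γ : R) (m N₁ N₂ : ℕ) : Type _ :=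
  Submodule R (Ambient R γ m N₁ N₂)

section Duality

variable {R : Type*} [CommRing R] {γ : R} {m N₁ N₂ : ℕ}

/-- Multiplication by `γ` as a map `R / ⟨γ ^ m⟩ → R`, sending the class of `r` to `γ * r`.
It is well defined because `γ ^ (m + 1) = 0`. -/
def gammaMul (h : γ ^ (m + 1) = 0) : (R ⧸ Ideal.span {γ ^ m}) →ₗ[R] R :=
  Submodule.liftQ (Ideal.span {γ ^ m}) (LinearMap.mulLeft R γ) (by
    intro x hx
    obtain ⟨a, rfl⟩ := Ideal.mem_span_singleton'.mp hx
    rw [LinearMap.mem_ker, LinearMap.mulLeft_apply]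
    calc γ * (a * γ ^ m) = a * γ ^ (m + 1) := by ring
      _ = 0 := by rw [h, mul_zero])

/-- The defining formula of `gammaMul`. -/
theorem gammaMul_mk (h : γ ^ (m + 1) = 0) (r : R) :
    gammaMul h (Ideal.Quotient.mk (Ideal.span {γ ^ m}) r) = γ * r := rfl

/-- The Euclidean form `∑ cᵢ cᵢ' + γ ∑ dⱼ dⱼ'`, with values in `R`. -/
def euclideanForm (h : γ ^ (m + 1) = 0) (x y : Ambient R γ m N₁ N₂) : R :=
  ∑ i, x.1 i * y.1 i + gammaMul h (∑ j, x.2 j * y.2 j)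

/-- The Euclidean dual code: all words orthogonal to every word of `C`. -/
def euclideanDual (h : γ ^ (m + 1) = 0) (C : Code R γ m N₁ N₂) : Code R γ m N₁ N₂ where
  carrier := {x | ∀ y ∈ C, euclideanForm h x y = 0}
  zero_mem' := by
    intro y _
    simp [euclideanForm]
  add_mem' := by
    intro a b ha hb y hy
    have h1 := ha y hy
    have h2 := hb y hy
    simp only [euclideanForm, Prod.fst_add, Prod.snd_add, Pi.add_apply, add_mul,
      Finset.sum_add_distrib, map_add] at h1 h2 ⊢
    linear_combination h1 + h2
  smul_mem' := by
    intro c x hx y hy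
    have h1 := hx y hy
    simp only [euclideanForm, Prod.smul_fst, Prod.smul_snd, Pi.smul_apply, smul_mul_assoc,
      ← Finset.smul_sum, map_smul] at h1 ⊢
    rw [← smul_add, h1, smul_zero]

/-- A code is Euclidean self-dual when it equals its Euclidean dual. -/
def IsSelfDual (h : γ ^ (m + 1) = 0) (C : Code R γ m N₁ N₂) : Prop :=
  C = euclideanDual h C

end Duality

/-- The Gaussian binomial coefficient
`((q^n - 1)(q^n - q)⋯(q^n - q^(s-1))) / ((q^s - 1)(q^s - q)⋯(q^s - q^(s-1)))`, for `s ≤ n`. -/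
def gaussBinom (q n s : ℕ) : ℚ :=
  (∏ i ∈ Finset.range s, ((q : ℚ) ^ n - (q : ℚ) ^ i)) /
    ∏ i ∈ Finset.range s, ((q : ℚ) ^ s - (q : ℚ) ^ i)

open Classical in
/-- The sign `1` if `(-1)^(n/2)` is a square in `F` and `-1` otherwise (used for even `n`). -/
def nu (F : Type*) [Field F] (n : ℕ) : ℚ :=
  if IsSquare ((-1 : F) ^ (n / 2)) then 1 else -1

open Classical in
/-- The number `σ_q(n, s)`, `q = |F|`: it is `1` for `s = 0`, it is `0` for `s > ⌊n/2⌋`, and for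
`1 ≤ s ≤ ⌊n/2⌋` it is given by a product formula that depends on the parity of `n`. In that range
all subtractions in the exponents are of a smaller from a larger natural number. -/
def sigma (F : Type*) [Field F] (n s : ℕ) : ℚ :=
  let q : ℚ := (Nat.card F : ℚ)
  if s = 0 then 1
  else if n / 2 < s then 0
  else if Odd n then
    (∏ i ∈ Finset.range s, (q ^ (n - 1 - 2 * i) - 1)) / ∏ j ∈ Finset.Icc 1 s, (q ^ j - 1)
  else
    ((q ^ (n - s) - nu F n * q ^ (n / 2 - s) + nu F n * q ^ (n / 2) - 1) *
        ∏ i ∈ Finset.Icc 1 (s - 1), (q ^ (n - 2 * i) - 1)) /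
      ∏ j ∈ Finset.Icc 1 s, (q ^ j - 1)

end MixedCode

end

/-! Write F for the residue field. A self-dual code C leaves three traces over F: the torsion code T
(first-block reductions of the words x with γx in C), the residue code T₀ ≤ T (first-block
reductions of C), and the code Q of second-block reductions of the words of C whose first block
vanishes modulo γ. Self-duality forces T = T^⊥ and Q ≤ Q^⊥ (`torCode_eq_orthogonal`,
`resCode₂_le_orthogonal`). Conversely every T = T^⊥ yields the self-dual code `baseCode`, for which
T₀ and Q are zero (`isSelfDual_baseCode`). Existence is therefore the existence of a self-dual T
over F, that is, the non-vanishing of σ(N₁, N₁/2).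

For the count, T and Q are enumerated by σ and T₀ by a Gaussian binomial; what remains is the number
of codes over one triple (T, T₀, Q), found in `card_hasType` by double counting. Fix bases of T₀ and
Q and lift them to words. A lift with zero Gram matrix spans an isotropic Z, and Z + (D ∩ Z^⊥), with
D the base code of T, is the only code of the given type containing it (`existsUnique_neighbour`).
Every code of the type contains equally many lifts, a number determined by |C|² = |ambient module|.

The isotropic lifts are counted by killing the Gram matrix in two stages: first γ times it, then the
matrix itself. At each stage the obstruction is affine under a group of translations and its linear
part is onto all possible obstructions, because 2 is invertible and the bases are independent; so a
known fraction of the lifts survives (`card_zero_mul_card_eq`).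

The numbers σ come from counting isotropic vectors of the standard quadratic form by character sums,
extending isotropic tuples one vector at a time, and dividing by the number of bases of a subspace.
-/

open Module IsLocalRing

noncomputable section

namespace MixedCode

/-! ### Counting principles for finite groups, modules and vector spaces. -/

section Counting

/-- If `f` is affine along the translations by `G`, with linear part mapping `G` onto a group `H`
containing all the values of `f` on `Y`, then `f` takes each value equally often. -/
theorem card_zero_mul_card_eq {M K : Type*} [AddCommGroup M] [Finite M] [AddCommGroup K]
    (Y : Set M) (G : AddSubgroup M) (H : AddSubgroup K) (f : M → K)
    (hY : ∀ y ∈ Y, ∀ a ∈ G, y + a ∈ Y) (hf : ∀ y ∈ Y, f y ∈ H)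
    (hφ : ∀ y ∈ Y, ∃ φ : M →+ K, G.map φ = H ∧ ∀ a ∈ G, f (y + a) = f y + φ a) :
    Nat.card {y // y ∈ Y ∧ f y = 0} * Nat.card H = Nat.card Y := by
  classical
  have := Fintype.ofFinite M
  -- Pairs (zero of `f`, translation) are counted a second way by the translated-back point: (y, a)
  -- goes to (y - a, a).
  have e : {y // y ∈ Y ∧ f y = 0} × G ≃ Σ y : Y, {a : G // f (y + a) = 0} :=
    { toFun := fun p => ⟨⟨p.1.1 - p.2.1, by
          simpa [sub_eq_add_neg] using hY _ p.1.2.1 _ (G.neg_mem p.2.2)⟩,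
          ⟨p.2, by simpa using p.1.2.2⟩⟩
      invFun := fun p => (⟨p.1.1 + p.2.1.1, hY _ p.1.2 _ p.2.1.2, p.2.2⟩, p.2.1)
      left_inv := fun p => by simp
      right_inv := by
        rintro ⟨⟨y, hy⟩, ⟨a, ha⟩, h⟩
        exact Sigma.subtype_ext (by simp) rfl }
  have hfib : ∀ y : Y, Nat.card {a : G // f (y + a) = 0} * Nat.card H = Nat.card G := by
    rintro ⟨y, hy⟩
    obtain ⟨φ, rfl, hφ'⟩ := hφ y hy
    let ψ : G →+ K := φ.comp G.subtype
    have hr : ψ.range = G.map φ := by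
      rw [AddMonoidHom.range_eq_map, ← AddSubgroup.map_map]
      simp [← AddMonoidHom.range_eq_map]
    -- With `f y = φ b`, the translations leading from `y` to a zero form the coset of the kernel
    -- shifted by `-b`.
    obtain ⟨b, hb, hby⟩ := (hf y hy)
    have e' : {a : G // f (y + a) = 0} ≃ ψ.ker :=
      { toFun := fun a => ⟨a.1 + ⟨b, hb⟩, by
          have := a.2
          rw [hφ' _ a.1.2] at this
          change φ (a.1 + b) = 0
          rw [map_add, hby, add_comm, this]⟩
        invFun := fun a => ⟨a.1 - ⟨b, hb⟩, by
          have h := a.2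
          change φ a.1 = 0 at h
          rw [hφ' _ (a.1 - ⟨b, hb⟩ : G).2]
          change f y + φ (a.1 - b) = 0
          rw [map_sub, hby, h]; abel⟩
        left_inv := fun a => by simp
        right_inv := fun a => by simp }
    rw [Nat.card_congr e', ← hr, ← AddSubgroup.index_ker, AddSubgroup.card_mul_index]
  have h1 := Nat.card_congr e
  rw [Nat.card_prod, Nat.card_sigma] at h1
  have hG : 0 < Nat.card G := Nat.card_pos
  apply Nat.eq_of_mul_eq_mul_right hG
  calc _ = (Nat.card {y // y ∈ Y ∧ f y = 0} * Nat.card G) * Nat.card H := by ring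
    _ = ∑ y : Y, Nat.card G := by
      rw [h1, Finset.sum_mul]; exact Finset.sum_congr rfl fun y _ => hfib y
    _ = _ := by simp [Nat.card_eq_fintype_card]

/-- Over a finite ring with a simple essential socle, a nondegenerate form satisfies the double
annihilator cardinality formula. -/
theorem card_mul_card_orthogonal {R M : Type*} [CommRing R] [Finite R] [AddCommGroup M]
    [Module R M] [Finite M] (B : M →ₗ[R] M →ₗ[R] R) (s : R) (hs : s ≠ 0)
    (hsoc : ∀ r : R, r ≠ 0 → ∃ t, t * r = s) (hB : ∀ x, (∀ y, B x y = 0) → x = 0)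
    (X : Submodule R M) :
    Nat.card X * Nat.card (X.orthogonalBilin B) = Nat.card M := by
  classical
  have := Fintype.ofFinite M
  -- Every nonzero ideal contains `s`, so a character nontrivial at `s` is nontrivial on the image
  -- of any nonzero linear map into `R`. Both partial sums of `χ` are then multiples of indicator
  -- functions.
  obtain ⟨ψ, hψ⟩ := AddChar.exists_apply_ne_zero.2 hs
  let χ (x m : M) : ℂ := ψ (B x m)
  have h1 (x : M) : ∑ m, χ x m = if x = 0 then (Nat.card M : ℂ) else 0 := by
    have := AddChar.sum_eq_ite (ψ.compAddMonoidHom (B x).toAddMonoidHom)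
    have hiff : ψ.compAddMonoidHom (B x).toAddMonoidHom = 0 ↔ x = 0 := by
      constructor
      · intro h
        apply hB
        intro y
        by_contra hy
        obtain ⟨t, ht⟩ := hsoc _ hy
        apply hψ
        have h2 := DFunLike.congr_fun h (t • y)
        simpa [ht] using h2
      · rintro rfl
        ext y
        simp
    simp only [hiff, ← Nat.card_eq_fintype_card] at this
    exact this
  have h2 (m : M) : ∑ x : X, χ x m =
      if m ∈ X.orthogonalBilin B then (Nat.card X : ℂ) else 0 := by
    let g : X →ₗ[R] R := (B.flip m).comp X.subtype
    have := AddChar.sum_eq_ite (ψ.compAddMonoidHom g.toAddMonoidHom)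
    have hiff : ψ.compAddMonoidHom g.toAddMonoidHom = 0 ↔ m ∈ X.orthogonalBilin B := by
      rw [Submodule.mem_orthogonalBilin_iff]
      constructor
      · intro h x hx
        by_contra hy
        obtain ⟨t, ht⟩ := hsoc _ hy
        apply hψ
        have h2 := DFunLike.congr_fun h (t • ⟨x, hx⟩)
        simpa [g, ht] using h2
      · intro h
        ext ⟨y, hy⟩
        simp [g, show B y m = 0 from h y hy]
    simp only [hiff, ← Nat.card_eq_fintype_card] at this
    exact this
  have h3 : ∑ x : X, ∑ m, χ x m = Nat.card M := by
    simp_rw [h1]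
    rw [Finset.sum_eq_single (0 : X)] <;> simp +contextual
  rw [Finset.sum_comm] at h3
  simp_rw [h2] at h3
  rw [← Finset.sum_filter, Finset.sum_const, nsmul_eq_mul] at h3
  have h4 : (Finset.univ.filter (· ∈ X.orthogonalBilin B)).card
      = Nat.card (X.orthogonalBilin B) := by
    rw [Nat.card_eq_fintype_card]
    exact (Fintype.card_subtype _).symm
  rw [h4] at h3
  rw [mul_comm]
  exact_mod_cast h3

/-- Subspaces of dimension `k` with property `P`, counted by their bases. -/
theorem card_subspaces_mul {K V : Type*} [Field K] [Finite K] [AddCommGroup V] [Module K V]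
    [Finite V] (k : ℕ) (P : Submodule K V → Prop) :
    (Nat.card {W : Submodule K V // finrank K W = k ∧ P W} : ℚ) *
        ∏ i ∈ Finset.range k, ((Nat.card K : ℚ) ^ k - (Nat.card K : ℚ) ^ i) =
      Nat.card {v : Fin k → V // LinearIndependent K v ∧ P (Submodule.span K (Set.range v))} := by
  classical
  have := Fintype.ofFinite K
  have : Finite (Submodule K V) := Finite.of_injective _ (SetLike.coe_injective)
  have := Fintype.ofFinite {W : Submodule K V // finrank K W = k ∧ P W}
  have hspan (W : Submodule K V) (hW : finrank K W = k) (v : Fin k → W)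
      (hv : LinearIndependent K v) :
      LinearIndependent K (fun i => (v i : V)) ∧
        Submodule.span K (Set.range fun i => (v i : V)) = W := by
    have h := hv.map' (Submodule.subtype _) (Submodule.ker_subtype _)
    refine ⟨h, Submodule.eq_of_le_of_finrank_eq ?_ ?_⟩
    · rw [Submodule.span_le]
      rintro _ ⟨i, rfl⟩
      exact (v i).2
    · rw [hW]
      exact (finrank_span_eq_card h).trans (Fintype.card_fin k)
  let g : (Σ W : {W : Submodule K V // finrank K W = k ∧ P W},
        {v : Fin k → W.1 // LinearIndependent K v}) →
      {v : Fin k → V // LinearIndependent K v ∧ P (Submodule.span K (Set.range v))} :=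
    fun p => ⟨fun i => p.2.1 i, (hspan _ p.1.2.1 _ p.2.2).1, by
      rw [(hspan _ p.1.2.1 _ p.2.2).2]; exact p.1.2.2⟩
  have hg : Function.Bijective g := by
    constructor
    · rintro ⟨⟨W, hW, hP⟩, ⟨v, hv⟩⟩ ⟨⟨W', hW', hP'⟩, ⟨v', hv'⟩⟩ h
      have h0 : (fun i => (v i : V)) = fun i => (v' i : V) := congrArg Subtype.val h
      have h1 := (hspan W hW v hv).2
      have h2 := (hspan W' hW' v' hv').2
      obtain rfl : W = W' := by rw [← h1, ← h2, h0]
      obtain rfl : v = v' := funext fun i => Subtype.ext (congrFun h0 i)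
      rfl
    · rintro ⟨v, hv, hP⟩
      refine ⟨⟨⟨Submodule.span K (Set.range v), ?_, hP⟩,
        ⟨fun i => ⟨v i, Submodule.subset_span ⟨i, rfl⟩⟩, ?_⟩⟩, rfl⟩
      · rw [finrank_span_eq_card hv, Fintype.card_fin]
      · exact LinearIndependent.of_comp (Submodule.subtype _) hv
  rw [← Nat.card_congr (Equiv.ofBijective g hg), Nat.card_sigma, Nat.cast_sum]
  rw [Finset.sum_congr rfl (g := fun _ => ∏ i ∈ Finset.range k,
    ((Nat.card K : ℚ) ^ k - (Nat.card K : ℚ) ^ i))]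
  · simp [Nat.card_eq_fintype_card]
  · rintro ⟨W, hW, hP⟩ -
    rw [card_linearIndependent hW.ge, hW, Nat.cast_prod, Finset.prod_range]
    refine Finset.prod_congr rfl fun i _ => ?_
    rw [Nat.cast_sub (Nat.pow_le_pow_right Fintype.card_pos i.2.le)]
    simp [Nat.card_eq_fintype_card]

end Counting

/-! ### Isotropic vectors of the standard quadratic form over a finite field. -/

section Spheres

variable {F : Type*} [Field F] [Fintype F] [DecidableEq F]

/-- For nonzero `b`, the substitution of `b * s` for `s` gives the Jacobi sum of the quadratic
character with itself, which is its own inverse. -/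
theorem sum_quadraticChar_mul (hF : ringChar F ≠ 2) (b : F) :
    ∑ s, quadraticChar F s * quadraticChar F (b - s) =
      if b = 0 then quadraticChar F (-1) * (Fintype.card F - 1) else -quadraticChar F (-1) := by
  have hχ := quadraticChar_ne_one hF
  split_ifs with hb
  · subst hb
    have h (s : F) : quadraticChar F s * quadraticChar F (0 - s) =
        quadraticChar F (-1) * if s = 0 then 0 else 1 := by
      rw [zero_sub, neg_eq_neg_one_mul, map_mul]
      split_ifs with hs
      · simp [hs]
      · linear_combination quadraticChar F (-1) * quadraticChar_sq_one hs
    simp_rw [h]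
    rw [← Finset.mul_sum]
    have h2 : ∑ s : F, (if s = 0 then (0 : ℤ) else 1) = Fintype.card F - 1 := by
      have : ∀ s : F, (if s = 0 then (0 : ℤ) else 1) = 1 - if s = 0 then 1 else 0 := by
        intro s; split_ifs <;> rfl
      simp_rw [this, Finset.sum_sub_distrib]
      simp
    rw [h2]
  · have h := jacobiSum_nontrivial_inv hχ
    rw [(quadraticChar_isQuadratic F).inv, jacobiSum] at h
    rw [← h, ← Equiv.sum_comp (Equiv.mulLeft₀ b hb)]
    refine Finset.sum_congr rfl fun s _ => ?_
    have h1 : b - b * s = b * (1 - s) := by ring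
    rw [Equiv.mulLeft₀_apply, h1, map_mul, map_mul]
    linear_combination quadraticChar F s * quadraticChar F (1 - s) * quadraticChar_sq_one hb

theorem sum_sq_eq (hF : ringChar F ≠ 2) (b : F) :
    ∑ v : F, (if v ^ 2 = b then (1 : ℤ) else 0) = quadraticChar F b + 1 := by
  rw [← quadraticChar_card_sqrts hF, Finset.sum_boole]
  simp

theorem sum_sq_add_sq_eq (hF : ringChar F ≠ 2) (b : F) :
    ∑ u : F, ∑ v : F, (if u ^ 2 + v ^ 2 = b then (1 : ℤ) else 0) =
      Fintype.card F - quadraticChar F (-1) +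
        if b = 0 then Fintype.card F * quadraticChar F (-1) else 0 := by
  have h1 (u : F) : ∑ v : F, (if u ^ 2 + v ^ 2 = b then (1 : ℤ) else 0) =
      1 + ∑ s : F, (if u ^ 2 = s then 1 else 0) * quadraticChar F (b - s) := by
    simp_rw [← eq_sub_iff_add_eq', sum_sq_eq hF]
    simp [add_comm]
  have h2 : ∑ s : F, quadraticChar F (b - s) = 0 := by
    rw [← quadraticChar_sum_zero hF]
    exact (Equiv.subLeft b).sum_comp (fun s => quadraticChar F s)
  simp_rw [h1]
  rw [Finset.sum_add_distrib, Finset.sum_comm]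
  simp_rw [← Finset.sum_mul, sum_sq_eq hF, add_mul, one_mul]
  rw [Finset.sum_add_distrib, h2, sum_quadraticChar_mul hF]
  split_ifs <;> simp only [Finset.sum_const, Finset.card_univ, nsmul_eq_mul] <;> ring

/-- Splitting off two coordinates leaves u² + v² = a - x·x, whose number of solutions depends only
on whether the right side is zero. Hence a recursion of step two, separating the parities of the
dimension. -/
theorem card_sphere_add_two (hF : ringChar F ≠ 2) (n : ℕ) (a : F) :
    (Nat.card {x : Fin (n + 2) → F // x ⬝ᵥ x = a} : ℤ) =
      (Fintype.card F - quadraticChar F (-1)) * Fintype.card F ^ n +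
        Fintype.card F * quadraticChar F (-1) * Nat.card {x : Fin n → F // x ⬝ᵥ x = a} := by
  have key (m : ℕ) (a : F) : (Nat.card {x : Fin m → F // x ⬝ᵥ x = a} : ℤ) =
      ∑ x : Fin m → F, if x ⬝ᵥ x = a then 1 else 0 := by
    rw [Finset.sum_boole, Nat.card_eq_fintype_card, Fintype.card_subtype]
  rw [key, key, ← (Fin.consEquiv fun _ => F).sum_comp, Fintype.sum_prod_type]
  have h1 (g : (Fin (n + 1) → F) → ℤ) : ∑ y, g y = ∑ v, ∑ x, g (Fin.cons v x) := by
    rw [← (Fin.consEquiv fun _ => F).sum_comp, Fintype.sum_prod_type]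
    rfl
  simp_rw [h1]
  have h2 (u v : F) (x : Fin n → F) :
      (if (Fin.consEquiv fun _ => F) (u, (Fin.cons v x : Fin (n + 1) → F)) ⬝ᵥ
      (Fin.consEquiv fun _ => F) (u, (Fin.cons v x : Fin (n + 1) → F)) = a then (1 : ℤ) else 0) =
      if u ^ 2 + v ^ 2 = a - x ⬝ᵥ x then 1 else 0 := by
    congr 1
    simp only [Fin.consEquiv, Equiv.coe_fn_mk, dotProduct, Fin.sum_univ_succ, Fin.cons_zero,
      Fin.cons_succ, eq_iff_iff, eq_sub_iff_add_eq]
    ring_nf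
  simp_rw [h2]
  have h3 : ∑ u : F, ∑ v : F, ∑ x : Fin n → F,
      (if u ^ 2 + v ^ 2 = a - x ⬝ᵥ x then (1 : ℤ) else 0) =
      ∑ x : Fin n → F, ∑ u : F, ∑ v : F, if u ^ 2 + v ^ 2 = a - x ⬝ᵥ x then 1 else 0 := by
    rw [Finset.sum_comm]
    simp_rw [Finset.sum_comm (γ := Fin n → F)]
    rw [Finset.sum_comm]
  rw [h3]
  simp_rw [sum_sq_add_sq_eq hF, sub_eq_zero]
  rw [Finset.sum_add_distrib, Finset.mul_sum]
  congr 1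
  · simp
    ring
  · refine Finset.sum_congr rfl fun x _ => ?_
    simp [eq_comm]

/-- The sign is a power of the quadratic character of `-1`. -/
theorem nu_eq (n : ℕ) : nu F n = ((quadraticChar F (-1)) ^ (n / 2) : ℤ) := by
  have h0 : ((-1 : F) ^ (n / 2)) ≠ 0 := pow_ne_zero _ (neg_ne_zero.2 one_ne_zero)
  rw [nu, ← map_pow]
  split_ifs with h
  · rw [(quadraticChar_one_iff_isSquare h0).2 h]; simp
  · rw [quadraticChar_neg_one_iff_not_isSquare.2 h]; simp

/-- The extra factor q clears the exponent m - 1, so that the recursion can start at m = 0. -/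
theorem card_isotropic_even (hF : ringChar F ≠ 2) (m : ℕ) :
    (Fintype.card F : ℚ) * Nat.card {x : Fin (2 * m) → F // x ⬝ᵥ x = 0} =
      Fintype.card F ^ (2 * m) + nu F (2 * m) * (Fintype.card F ^ (m + 1) - Fintype.card F ^ m) := by
  rw [nu_eq, Nat.mul_div_cancel_left _ two_pos]
  norm_cast
  have : (Fintype.card F : ℤ) * Nat.card {x : Fin (2 * m) → F // x ⬝ᵥ x = 0} =
      Fintype.card F ^ (2 * m) + quadraticChar F (-1) ^ m *
        (Fintype.card F ^ (m + 1) - Fintype.card F ^ m) := by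
    induction m with
    | zero => simp
    | succ m ih =>
      rw [mul_add_one, card_sphere_add_two hF, pow_succ _ m]
      linear_combination (Fintype.card F : ℤ) * quadraticChar F (-1) * ih
  rw [Int.subNatNat_eq_coe]
  push_cast
  exact_mod_cast this

theorem card_isotropic_odd (hF : ringChar F ≠ 2) (m : ℕ) :
    (Nat.card {x : Fin (2 * m + 1) → F // x ⬝ᵥ x = 0} : ℚ) = Fintype.card F ^ (2 * m) := by
  have : (Nat.card {x : Fin (2 * m + 1) → F // x ⬝ᵥ x = 0} : ℤ) = Fintype.card F ^ (2 * m) := by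
    induction m with
    | zero =>
      have : Unique {x : Fin (2 * 0 + 1) → F // x ⬝ᵥ x = 0} :=
        { default := ⟨0, by simp⟩
          uniq := by
            rintro ⟨x, hx⟩
            ext i
            fin_cases i
            simpa [dotProduct] using hx }
      simp
    | succ m ih =>
      rw [mul_add_one, show 2 * m + 2 + 1 = 2 * m + 1 + 2 by ring, card_sphere_add_two hF, ih]
      ring
  exact_mod_cast this

end Spheres

/-! ### Orthogonal complements and isotropic tuples. -/

section Isotropic

variable {F : Type*} [Field F] {n : ℕ}

theorem mem_orthogonal_span {s : ℕ} (v : Fin s → Fin n → F) (x : Fin n → F) :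
    x ∈ (Submodule.span F (Set.range v)).orthogonalBilin (dotProductBilin F F) ↔
      ∀ i, v i ⬝ᵥ x = 0 := by
  rw [Submodule.mem_orthogonalBilin_iff]
  constructor
  · intro h i
    exact h _ (Submodule.subset_span ⟨i, rfl⟩)
  · intro h y hy
    change y ⬝ᵥ x = 0
    induction hy using Submodule.span_induction with
    | mem y hy => obtain ⟨i, rfl⟩ := hy; exact h i
    | zero => simp
    | add a b _ _ ha hb => rw [add_dotProduct, ha, hb, add_zero]
    | smul c a _ ha => rw [smul_dotProduct, ha, smul_zero]

variable [Fintype F]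

theorem card_mul_card_dotProduct_orthogonal (U : Submodule F (Fin n → F)) :
    Nat.card U * Nat.card (U.orthogonalBilin (dotProductBilin F F)) = Fintype.card F ^ n := by
  rw [card_mul_card_orthogonal (dotProductBilin F F) (1 : F) one_ne_zero
    (fun r hr => ⟨r⁻¹, inv_mul_cancel₀ hr⟩) (fun x hx => dotProduct_eq_zero x hx) U]
  simp [Nat.card_eq_fintype_card]

theorem card_orthogonal_tuple {s : ℕ} (v : Fin s → Fin n → F) (hv : LinearIndependent F v) :
    Fintype.card F ^ s * Nat.card {x : Fin n → F // ∀ i, v i ⬝ᵥ x = 0} = Fintype.card F ^ n := by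
  rw [← card_mul_card_dotProduct_orthogonal (Submodule.span F (Set.range v))]
  congr 1
  · rw [Module.natCard_eq_pow_finrank (K := F), finrank_span_eq_card hv, Fintype.card_fin,
      Nat.card_eq_fintype_card]
  · exact Nat.card_congr (Equiv.subtypeEquivRight fun x => (mem_orthogonal_span v x).symm)

/-- Induction on the tuple. The isotropic vectors lost on imposing orthogonality to one more vector
are exactly 1/q of all the vectors lost, by equidistribution of x·x along lines. -/
theorem card_isotropic_extension (h2 : (2 : F) ≠ 0) {s : ℕ} (v : Fin s → Fin n → F)
    (hv : LinearIndependent F v) (hiso : ∀ i j, v i ⬝ᵥ v j = 0) :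
    (Fintype.card F : ℚ) * Nat.card {x : Fin n → F // (∀ i, v i ⬝ᵥ x = 0) ∧ x ⬝ᵥ x = 0} =
      Fintype.card F * Nat.card {x : Fin n → F // x ⬝ᵥ x = 0} - Fintype.card F ^ n +
        (Fintype.card F ^ n / Fintype.card F ^ s) := by
  have hq : (Fintype.card F : ℚ) ≠ 0 := by simp
  induction s with
  | zero => simp
  | succ s ih =>
    have hc := card_orthogonal_tuple v hv
    have hc' := card_orthogonal_tuple _ (linearIndependent_finSucc.1 hv).1
    have ih := ih _ (linearIndependent_finSucc.1 hv).1 fun i j => hiso i.succ j.succ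
    have hfa (x : Fin n → F) : (∀ i, v i ⬝ᵥ x = 0) ↔
        (∀ i, Fin.tail v i ⬝ᵥ x = 0) ∧ v 0 ⬝ᵥ x = 0 := by
      rw [Fin.forall_fin_succ, and_comm]; rfl
    -- Translation by c·v₀ changes x·x by 2c(v₀·x), since v₀ is isotropic; when v₀·x is nonzero,
    -- this runs through the whole field.
    have hY := card_zero_mul_card_eq
      (Y := {x : Fin n → F | (∀ i, Fin.tail v i ⬝ᵥ x = 0) ∧ v 0 ⬝ᵥ x ≠ 0})
      (G := (Submodule.span F {v 0}).toAddSubgroup) (H := (⊤ : AddSubgroup F))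
      (f := fun x => x ⬝ᵥ x)
      (by
        rintro y ⟨h, h'⟩ a ha
        obtain ⟨c, rfl⟩ := Submodule.mem_span_singleton.1 ha
        refine ⟨fun i => ?_, ?_⟩
        · rw [dotProduct_add, h, dotProduct_smul, show Fin.tail v i ⬝ᵥ v 0 = 0 from hiso _ _]
          simp
        · rwa [dotProduct_add, dotProduct_smul, hiso, smul_zero, add_zero])
      (fun _ _ => AddSubgroup.mem_top _)
      (by
        rintro y ⟨h, h'⟩
        refine ⟨((2 : F) • dotProductBilin F F y).toAddMonoidHom, ?_, ?_⟩
        · rw [eq_top_iff]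
          rintro c -
          refine ⟨(c / (2 * (v 0 ⬝ᵥ y))) • v 0, Submodule.mem_span_singleton.2 ⟨_, rfl⟩, ?_⟩
          change 2 * (y ⬝ᵥ _) = c
          have h'' : y ⬝ᵥ v 0 ≠ 0 := by rwa [dotProduct_comm]
          rw [dotProduct_smul, dotProduct_comm (v 0) y, smul_eq_mul]
          field_simp
        · intro a ha
          obtain ⟨c, rfl⟩ := Submodule.mem_span_singleton.1 ha
          change _ = _ + 2 * (y ⬝ᵥ _)
          simp only [dotProduct_add, add_dotProduct, dotProduct_smul, smul_dotProduct, hiso]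
          rw [dotProduct_comm (v 0) y]
          simp only [smul_zero, add_zero]
          ring)
    rw [AddSubgroup.card_top, Nat.card_eq_fintype_card (α := F)] at hY
    have hsplit (p q r : (Fin n → F) → Prop) (hr : ∀ x, r x ↔ p x ∧ q x) :
        Nat.card {x // p x} = Nat.card {x // r x} + Nat.card {x // p x ∧ ¬ q x} := by
      classical
      rw [← Nat.card_congr (Equiv.sumCompl fun x : {x // p x} => q x.1), Nat.card_sum]
      congr 1
      · exact Nat.card_congr ((Equiv.subtypeSubtypeEquivSubtypeInter _ _).trans
          (Equiv.subtypeEquivRight fun x => (hr x).symm))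
      · exact Nat.card_congr (Equiv.subtypeSubtypeEquivSubtypeInter p (fun x => ¬ q x))
    have e1 := hsplit (fun x => ∀ i, Fin.tail v i ⬝ᵥ x = 0) (fun x => v 0 ⬝ᵥ x = 0) _ hfa
    have e2 := hsplit (fun x => (∀ i, Fin.tail v i ⬝ᵥ x = 0) ∧ x ⬝ᵥ x = 0)
      (fun x => v 0 ⬝ᵥ x = 0) (fun x => (∀ i, v i ⬝ᵥ x = 0) ∧ x ⬝ᵥ x = 0)
      (fun x => by rw [hfa]; tauto)
    have e3 : Nat.card {y : Fin n → F //
        y ∈ {x : Fin n → F | (∀ i, Fin.tail v i ⬝ᵥ x = 0) ∧ v 0 ⬝ᵥ x ≠ 0} ∧ y ⬝ᵥ y = 0} =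
        Nat.card {x : Fin n → F // ((∀ i, Fin.tail v i ⬝ᵥ x = 0) ∧ x ⬝ᵥ x = 0) ∧ ¬ v 0 ⬝ᵥ x = 0} :=
      Nat.card_congr (Equiv.subtypeEquivRight fun x => by
        simp only [Set.mem_ofPred_eq]; tauto)
    rw [e3] at hY
    replace hY : _ = Nat.card {x : Fin n → F // (∀ i, Fin.tail v i ⬝ᵥ x = 0) ∧ ¬ v 0 ⬝ᵥ x = 0} := hY
    rw [e2] at ih
    rw [← hY] at e1
    rw [e1] at hc'
    generalize Nat.card {x : Fin n → F //
      ((∀ i, Fin.tail v i ⬝ᵥ x = 0) ∧ x ⬝ᵥ x = 0) ∧ ¬ v 0 ⬝ᵥ x = 0} = A at *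
    generalize Nat.card {x : Fin n → F // (∀ i, v i ⬝ᵥ x = 0) ∧ x ⬝ᵥ x = 0} = C at *
    generalize Nat.card {x : Fin n → F // (∀ i, v i ⬝ᵥ x = 0)} = D at *
    have hcq : (Fintype.card F : ℚ) ^ (s + 1) * D = Fintype.card F ^ n := by exact_mod_cast hc
    have hcq' : (Fintype.card F : ℚ) ^ s * (D + A * Fintype.card F) = Fintype.card F ^ n := by
      exact_mod_cast hc'
    have hD : (Fintype.card F : ℚ) ^ n / Fintype.card F ^ (s + 1) = D := by
      rw [← hcq]; field_simp
    have hD' : (Fintype.card F : ℚ) ^ n / Fintype.card F ^ s = D + A * Fintype.card F := by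
      rw [← hcq']; field_simp
    rw [hD]
    rw [hD'] at ih
    push_cast at ih
    linear_combination ih

/-- A tuple grows by an isotropic vector orthogonal to it and outside its span. The span itself
consists of isotropic vectors orthogonal to the tuple, which explains the subtracted power of q. -/
theorem card_isotropic_tuples (h2 : (2 : F) ≠ 0) (s : ℕ) :
    (Nat.card {v : Fin s → Fin n → F // LinearIndependent F v ∧ ∀ i j, v i ⬝ᵥ v j = 0} : ℚ) =
      ∏ i ∈ Finset.range s, (Nat.card {x : Fin n → F // x ⬝ᵥ x = 0} -
        Fintype.card F ^ n / Fintype.card F +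
          (Fintype.card F ^ n / Fintype.card F ^ (i + 1)) - Fintype.card F ^ i : ℚ) := by
  have hq : (Fintype.card F : ℚ) ≠ 0 := by simp
  induction s with
  | zero =>
    have : Unique {v : Fin 0 → Fin n → F // LinearIndependent F v ∧ ∀ i j, v i ⬝ᵥ v j = 0} :=
      { default := ⟨Fin.elim0, linearIndependent_empty_type, fun i => i.elim0⟩
        uniq := fun v => Subtype.ext (Subsingleton.elim _ _) }
    simp
  | succ s ih =>
    let e : {v : Fin (s + 1) → Fin n → F // LinearIndependent F v ∧ ∀ i j, v i ⬝ᵥ v j = 0} ≃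
        Σ v : {v : Fin s → Fin n → F // LinearIndependent F v ∧ ∀ i j, v i ⬝ᵥ v j = 0},
          {x : Fin n → F // ((∀ i, v.1 i ⬝ᵥ x = 0) ∧ x ⬝ᵥ x = 0) ∧
            x ∉ Submodule.span F (Set.range v.1)} :=
      { toFun := fun v => ⟨⟨Fin.tail v.1, (linearIndependent_finSucc.1 v.2.1).1,
            fun i j => v.2.2 i.succ j.succ⟩, ⟨v.1 0, ⟨fun i => v.2.2 i.succ 0, v.2.2 0 0⟩,
            (linearIndependent_finSucc.1 v.2.1).2⟩⟩
        invFun := fun p => ⟨Fin.cons p.2.1 p.1.1, by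
          refine ⟨linearIndependent_finCons.2 ⟨p.1.2.1, p.2.2.2⟩, fun i j => ?_⟩
          cases i using Fin.cases <;> cases j using Fin.cases
          · simpa using p.2.2.1.2
          · simpa [dotProduct_comm] using p.2.2.1.1 _
          · simpa using p.2.2.1.1 _
          · simpa using p.1.2.2 _ _⟩
        left_inv := fun v => by simp
        right_inv := fun p => rfl }
    have := Fintype.ofFinite
      {v : Fin s → Fin n → F // LinearIndependent F v ∧ ∀ i j, v i ⬝ᵥ v j = 0}
    rw [Nat.card_congr e, Nat.card_sigma, Nat.cast_sum, Finset.prod_range_succ, ← ih]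
    rw [Finset.sum_congr rfl, Finset.sum_const, nsmul_eq_mul]
    · rw [Finset.card_univ, Nat.card_eq_fintype_card]
    · rintro ⟨v, hv, hiso⟩ -
      have h1 := card_isotropic_extension h2 v hv hiso
      have h3 : Nat.card {x : Fin n → F // (∀ i, v i ⬝ᵥ x = 0) ∧ x ⬝ᵥ x = 0} =
          Fintype.card F ^ s + Nat.card {x : Fin n → F //
            ((∀ i, v i ⬝ᵥ x = 0) ∧ x ⬝ᵥ x = 0) ∧ x ∉ Submodule.span F (Set.range v)} := by
        classical
        rw [← Nat.card_congr (Equiv.sumCompl fun x : {x : Fin n → F //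
          (∀ i, v i ⬝ᵥ x = 0) ∧ x ⬝ᵥ x = 0} => x.1 ∈ Submodule.span F (Set.range v)),
          Nat.card_sum]
        congr 1
        · have hle : ∀ x ∈ Submodule.span F (Set.range v),
              (∀ i, v i ⬝ᵥ x = 0) ∧ x ⬝ᵥ x = 0 := by
            have key : ∀ x ∈ Submodule.span F (Set.range v), ∀ i, v i ⬝ᵥ x = 0 := by
              intro x hx i
              rw [dotProduct_comm]
              refine (Submodule.mem_orthogonalBilin_iff.1 ((mem_orthogonal_span v (v i)).2
                fun j => hiso j i)) x hx
            intro x hx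
            refine ⟨key x hx, ?_⟩
            exact Submodule.mem_orthogonalBilin_iff.1 ((mem_orthogonal_span v x).2 (key x hx)) x hx
          have hs : Nat.card (Submodule.span F (Set.range v)) = Fintype.card F ^ s := by
            rw [Module.natCard_eq_pow_finrank (K := F), finrank_span_eq_card hv, Fintype.card_fin,
              Nat.card_eq_fintype_card]
          rw [← hs]
          exact Nat.card_congr (Equiv.subtypeSubtypeEquivSubtype fun {x} hx => hle x hx)
        · exact Nat.card_congr (Equiv.subtypeSubtypeEquivSubtypeInter _
            (fun x => x ∉ Submodule.span F (Set.range v)))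
      rw [h3] at h1
      push_cast at h1
      have h4 : (Nat.card {x : Fin n → F // ((∀ i, v i ⬝ᵥ x = 0) ∧ x ⬝ᵥ x = 0) ∧
          x ∉ Submodule.span F (Set.range v)} : ℚ) =
          (Fintype.card F * (Fintype.card F ^ s + Nat.card {x : Fin n → F //
            ((∀ i, v i ⬝ᵥ x = 0) ∧ x ⬝ᵥ x = 0) ∧ x ∉ Submodule.span F (Set.range v)})) /
              Fintype.card F - Fintype.card F ^ s := by
        field_simp; ring
      rw [h4, h1]
      field_simp
      ring

end Isotropic

/-! ### From tuples to subspaces: σ and the Gaussian binomial. -/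

section SubspaceCounts

theorem prod_pow_sub_pow (q : ℚ) (s : ℕ) :
    ∏ i ∈ Finset.range s, (q ^ s - q ^ i) =
      (∏ i ∈ Finset.range s, q ^ i) * ∏ j ∈ Finset.Icc 1 s, (q ^ j - 1) := by
  have h1 : ∏ j ∈ Finset.Icc 1 s, (q ^ j - 1) = ∏ i ∈ Finset.range s, (q ^ (s - i) - 1) := by
    refine Finset.prod_nbij' (fun j => s - j) (fun i => s - i) ?_ ?_ ?_ ?_ ?_ <;>
      simp only [Finset.mem_Icc, Finset.mem_range] <;> intro j hj
    · omega
    · omega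
    · omega
    · omega
    · congr 2
      omega
  rw [h1, ← Finset.prod_mul_distrib]
  refine Finset.prod_congr rfl fun i hi => ?_
  rw [Finset.mem_range] at hi
  rw [mul_sub, ← pow_add, mul_one, Nat.add_sub_cancel' hi.le]

/-- The second bracket of one factor and the first bracket of the next multiply to a difference of
squares. Only the two outermost brackets remain, and their product is the irregular factor of σ for
even n. -/
theorem prod_sub_mul_add (q ν : ℚ) (hν : ν ^ 2 = 1) (m s : ℕ) (hs : s + 1 ≤ m) :
    ∏ i ∈ Finset.range (s + 1), ((q ^ (m - i) - ν) * (q ^ (m - (i + 1)) + ν)) =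
      (q ^ (2 * m - (s + 1)) - ν * q ^ (m - (s + 1)) + ν * q ^ m - 1) *
        ∏ i ∈ Finset.Icc 1 s, (q ^ (2 * m - 2 * i) - 1) := by
  have hmul (k : ℕ) (hk : k ≤ m) : q ^ (2 * m - k) = q ^ m * q ^ (m - k) := by
    rw [← pow_add]; congr 1; omega
  induction s with
  | zero =>
    rw [hmul _ hs]
    simp
    linear_combination -hν
  | succ s ih =>
    rw [Finset.prod_range_succ, ih (by omega), Finset.prod_Icc_succ_top (by omega),
      hmul _ hs, hmul _ (by omega), show 2 * m - 2 * (s + 1) = (m - (s + 1)) + (m - (s + 1)) by omega,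
      pow_add]
    generalize ∏ i ∈ Finset.Icc 1 s, (q ^ (2 * m - 2 * i) - 1) = A
    generalize q ^ (m - (s + 1 + 1)) = x
    generalize q ^ (m - (s + 1)) = y
    generalize q ^ m = z
    linear_combination A * (-z * ν - z * x + y * ν + y * x - y ^ 2 + 1) * hν

variable {F : Type*} [Field F]

theorem span_isotropic_iff {n s : ℕ} (v : Fin s → Fin n → F) :
    Submodule.span F (Set.range v) ≤
      (Submodule.span F (Set.range v)).orthogonalBilin (dotProductBilin F F) ↔
      ∀ i j, v i ⬝ᵥ v j = 0 := by
  rw [Submodule.span_le, Set.range_subset_iff]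
  simp_rw [SetLike.mem_coe, mem_orthogonal_span]
  exact forall_comm

variable [Fintype F]

theorem nu_sq (n : ℕ) : nu F n ^ 2 = 1 := by
  rw [nu]; split_ifs <;> norm_num

theorem two_mul_finrank_le {n : ℕ} {W : Submodule F (Fin n → F)}
    (hW : W ≤ W.orthogonalBilin (dotProductBilin F F)) : 2 * finrank F W ≤ n := by
  have h1 := card_mul_card_dotProduct_orthogonal W
  have h2 : Nat.card W ≤ Nat.card (W.orthogonalBilin (dotProductBilin F F)) :=
    Nat.card_mono (Set.toFinite _) hW
  rw [Module.natCard_eq_pow_finrank (K := F) (V := W), Nat.card_eq_fintype_card] at h1 h2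
  rw [← Nat.pow_le_pow_iff_right (Fintype.one_lt_card (α := F)), ← h1, two_mul, pow_add]
  exact Nat.mul_le_mul_left _ h2

/-- The number of totally isotropic subspaces of dimension `s` of the standard quadratic space. -/
theorem card_isotropic_subspaces (h2 : (2 : F) ≠ 0) (n s : ℕ) :
    (Nat.card {W : Submodule F (Fin n → F) // finrank F W = s ∧
      W ≤ W.orthogonalBilin (dotProductBilin F F)} : ℚ) = sigma F n s := by
  classical
  have hF : ringChar F ≠ 2 := fun h => h2 <| by
    have := ringChar.Nat.cast_ringChar (R := F)
    rw [h] at this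
    exact_mod_cast this
  have hq1 : (1 : ℚ) < Fintype.card F := by exact_mod_cast Fintype.one_lt_card (α := F)
  have hq : (Fintype.card F : ℚ) ≠ 0 := by positivity
  rw [sigma]
  simp only [Nat.card_eq_fintype_card (α := F)]
  rcases lt_or_ge (n / 2) s with hs | hs
  · rw [if_neg (by omega), if_pos hs]
    have : IsEmpty {W : Submodule F (Fin n → F) // finrank F W = s ∧
        W ≤ W.orthogonalBilin (dotProductBilin F F)} := by
      refine ⟨fun W => ?_⟩
      have := two_mul_finrank_le W.2.2
      have := W.2.1
      omega
    simp
  have h := card_subspaces_mul s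
    (fun W : Submodule F (Fin n → F) => W ≤ W.orthogonalBilin (dotProductBilin F F))
  simp_rw [span_isotropic_iff] at h
  rw [card_isotropic_tuples h2, prod_pow_sub_pow, Nat.card_eq_fintype_card (α := F)] at h
  have hp : (∏ i ∈ Finset.range s, (Fintype.card F : ℚ) ^ i) ≠ 0 :=
    Finset.prod_ne_zero_iff.2 fun i _ => pow_ne_zero _ hq
  have hd : ∏ j ∈ Finset.Icc 1 s, ((Fintype.card F : ℚ) ^ j - 1) ≠ 0 :=
    Finset.prod_ne_zero_iff.2 fun i hi => by
      have := one_lt_pow₀ hq1 (n := i) (by rw [Finset.mem_Icc] at hi; omega)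
      linarith
  rw [← eq_div_iff (mul_ne_zero hp hd)] at h
  rw [h, ← div_div]
  split_ifs with h0 hlt hodd
  · subst h0; simp
  · omega
  · obtain ⟨m, rfl⟩ := hodd
    congr 1
    rw [card_isotropic_odd hF, div_eq_iff hp, ← Finset.prod_mul_distrib]
    refine Finset.prod_congr rfl fun i hi => ?_
    rw [Finset.mem_range] at hi
    have e1 : (Fintype.card F : ℚ) ^ (2 * m + 1) = Fintype.card F ^ (2 * m) * Fintype.card F :=
      pow_succ _ _
    have e2 : (Fintype.card F : ℚ) ^ (2 * m) * Fintype.card F = Fintype.card F ^ (i + 1) *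
        (Fintype.card F ^ (2 * m + 1 - 1 - 2 * i) * Fintype.card F ^ i) := by
      rw [← pow_succ, ← pow_add, ← pow_add]; congr 1; omega
    rw [e1, mul_div_cancel_right₀ _ hq, e2, mul_div_cancel_left₀ _ (pow_ne_zero _ hq)]
    ring
  · obtain ⟨m, rfl⟩ : ∃ m, n = 2 * m := by
      obtain ⟨m, rfl⟩ := Nat.not_odd_iff_even.1 hodd
      exact ⟨m, by ring⟩
    obtain ⟨t, rfl⟩ := Nat.exists_eq_succ_of_ne_zero h0
    rw [Nat.mul_div_cancel_left _ two_pos] at hs ⊢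
    congr 1
    rw [Nat.succ_sub_one, ← prod_sub_mul_add _ _ (nu_sq _) _ _ hs, div_eq_iff hp,
      ← Finset.prod_mul_distrib]
    refine Finset.prod_congr rfl fun i hi => ?_
    rw [Finset.mem_range] at hi
    have e0 := card_isotropic_even hF m
    -- The aim is that the i-th factor equals q^i (q^(m-i) - ν)(q^(m-i-1) + ν).
    have e3 : (Nat.card {x : Fin (2 * m) → F // x ⬝ᵥ x = 0} : ℚ) - Fintype.card F ^ (2 * m) /
        Fintype.card F = nu F (2 * m) * (Fintype.card F ^ m - Fintype.card F ^ m / Fintype.card F) := by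
      field_simp
      rw [pow_succ] at e0
      linear_combination e0
    have e4 : (Fintype.card F : ℚ) ^ m =
        Fintype.card F ^ (m - (i + 1)) * Fintype.card F ^ i * Fintype.card F := by
      rw [← pow_add, ← pow_succ]; congr 1; omega
    have e5 : (Fintype.card F : ℚ) ^ (m - i) = Fintype.card F ^ (m - (i + 1)) * Fintype.card F := by
      rw [← pow_succ]; congr 1; omega
    rw [e3, two_mul m, pow_add, e4, e5, pow_succ _ i]
    field_simp
    linear_combination nu_sq (F := F) (m + m)

/-- The Gaussian binomial coefficient counts subspaces of a subspace. -/
theorem card_subspaces_le {V : Type*} [AddCommGroup V] [Module F V] [Finite V]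
    (T : Submodule F V) (k : ℕ) (hk : k ≤ finrank F T) :
    (Nat.card {W : Submodule F V // finrank F W = k ∧ W ≤ T} : ℚ) =
      gaussBinom (Nat.card F) (finrank F T) k := by
  have hq1 : (1 : ℚ) < Fintype.card F := by exact_mod_cast Fintype.one_lt_card (α := F)
  have h := card_subspaces_mul k (fun W : Submodule F V => W ≤ T)
  have e : {v : Fin k → V // LinearIndependent F v ∧ Submodule.span F (Set.range v) ≤ T} ≃
      {v : Fin k → T // LinearIndependent F v} :=
    { toFun := fun v => ⟨fun i => ⟨v.1 i, v.2.2 (Submodule.subset_span ⟨i, rfl⟩)⟩,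
        LinearIndependent.of_comp (Submodule.subtype _) v.2.1⟩
      invFun := fun v => ⟨fun i => v.1 i, v.2.map' T.subtype T.ker_subtype, by
        rw [Submodule.span_le]
        rintro _ ⟨i, rfl⟩
        exact (v.1 i).2⟩
      left_inv := fun v => rfl
      right_inv := fun v => rfl }
  rw [Nat.card_congr e, card_linearIndependent hk] at h
  rw [gaussBinom, eq_div_iff, h, Nat.cast_prod, Finset.prod_range]
  · refine Finset.prod_congr rfl fun i _ => ?_
    rw [Nat.cast_sub (Nat.pow_le_pow_right Fintype.card_pos (by omega))]
    simp [Nat.card_eq_fintype_card]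
  · rw [Finset.prod_ne_zero_iff, Nat.card_eq_fintype_card]
    intro i hi
    have := pow_lt_pow_right₀ hq1 (Finset.mem_range.1 hi)
    linarith

/-- At s = n/2 the irregular factor of σ is (1 + ν)(q^(n/2) - 1), which vanishes for ν = -1. -/
theorem sigma_half_eq_zero {n : ℕ} (hn : Even n) (hpos : 0 < n)
    (h : ¬ IsSquare ((-1 : F) ^ (n / 2))) : sigma F n (n / 2) = 0 := by
  obtain ⟨m, rfl⟩ := hn
  rw [sigma, if_neg (by omega), if_neg (by omega), if_neg (by simp), nu, if_neg h,
    show m + m - (m + m) / 2 = (m + m) / 2 by omega, Nat.sub_self]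
  simp

theorem sigma_half_ne_zero {n : ℕ} (hn : Even n) (h : IsSquare ((-1 : F) ^ (n / 2))) :
    sigma F n (n / 2) ≠ 0 := by
  have hq1 : (1 : ℚ) < Nat.card F := by
    rw [Nat.card_eq_fintype_card]; exact_mod_cast Fintype.one_lt_card (α := F)
  have hlt (i : ℕ) (hi : i ≠ 0) : (0 : ℚ) < Nat.card F ^ i - 1 := by
    have := one_lt_pow₀ hq1 hi
    linarith
  obtain ⟨m, rfl⟩ := hn
  rw [sigma]
  split_ifs with h0 h1 h3
  · exact one_ne_zero
  · omega
  · exact absurd h3 (Nat.not_odd_iff_even.2 ⟨m, rfl⟩)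
  · rw [nu, if_pos h, show m + m - (m + m) / 2 = (m + m) / 2 by omega, Nat.sub_self]
    refine div_ne_zero (mul_ne_zero ?_ ?_) ?_
    · have := hlt _ h0
      rw [pow_zero]
      linarith
    · refine Finset.prod_ne_zero_iff.2 fun i hi => (hlt _ ?_).ne'
      rw [Finset.mem_Icc] at hi
      omega
    · refine Finset.prod_ne_zero_iff.2 fun i hi => (hlt _ ?_).ne'
      rw [Finset.mem_Icc] at hi
      omega

end SubspaceCounts

/-! ### The Euclidean form and formal properties of duality. -/

section FormBasics

variable {R : Type*} [CommRing R] {γ : R} {m N₁ N₂ : ℕ}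

/-- The word of the ambient module represented by a pair of vectors over `R`. -/
def word (γ : R) (m : ℕ) (c : Fin N₁ → R) (d : Fin N₂ → R) : Ambient R γ m N₁ N₂ :=
  (c, fun j => Ideal.Quotient.mk _ (d j))

theorem exists_word (x : Ambient R γ m N₁ N₂) : ∃ c d, x = word γ m c d := by
  choose d hd using fun j => Ideal.Quotient.mk_surjective (x.2 j)
  exact ⟨x.1, d, Prod.ext rfl (funext fun j => (hd j).symm)⟩

theorem smul_word (r : R) (c : Fin N₁ → R) (d : Fin N₂ → R) :
    r • word γ m c d = word γ m (r • c) (r • d) := rfl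

/-- The Euclidean form as a bilinear map. -/
def form (h : γ ^ (m + 1) = 0) :
    Ambient R γ m N₁ N₂ →ₗ[R] Ambient R γ m N₁ N₂ →ₗ[R] R :=
  LinearMap.mk₂ R (euclideanForm h)
    (fun a b c => by
      simp only [euclideanForm, Prod.fst_add, Prod.snd_add, Pi.add_apply, add_mul,
        Finset.sum_add_distrib, map_add]
      ring)
    (fun r a b => by
      simp only [euclideanForm, Prod.smul_fst, Prod.smul_snd, Pi.smul_apply, smul_mul_assoc,
        ← Finset.smul_sum, map_smul, smul_add])
    (fun a b c => by
      simp only [euclideanForm, Prod.fst_add, Prod.snd_add, Pi.add_apply, mul_add,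
        Finset.sum_add_distrib, map_add]
      ring)
    (fun r a b => by
      simp only [euclideanForm, Prod.smul_fst, Prod.smul_snd, Pi.smul_apply, mul_smul_comm,
        ← Finset.smul_sum, map_smul, smul_add])

theorem form_comm (h : γ ^ (m + 1) = 0) (x y : Ambient R γ m N₁ N₂) :
    form h x y = form h y x := by
  simp only [form, LinearMap.mk₂_apply, euclideanForm, mul_comm]

theorem form_word (h : γ ^ (m + 1) = 0) (c c' : Fin N₁ → R) (d d' : Fin N₂ → R) :
    form h (word γ m c d) (word γ m c' d') = c ⬝ᵥ c' + γ * (d ⬝ᵥ d') := by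
  simp only [form, LinearMap.mk₂_apply, euclideanForm, word, dotProduct]
  congr 1
  rw [← gammaMul_mk h, map_sum]
  simp

theorem mem_euclideanDual (h : γ ^ (m + 1) = 0) (C : Code R γ m N₁ N₂)
    (x : Ambient R γ m N₁ N₂) : x ∈ euclideanDual h C ↔ ∀ y ∈ C, form h x y = 0 := Iff.rfl

theorem euclideanDual_eq (h : γ ^ (m + 1) = 0) (C : Code R γ m N₁ N₂) :
    euclideanDual h C = C.orthogonalBilin (form h) := by
  ext x
  rw [mem_euclideanDual, Submodule.mem_orthogonalBilin_iff]
  simp_rw [form_comm h x]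

theorem euclideanDual_anti (h : γ ^ (m + 1) = 0) {C D : Code R γ m N₁ N₂} (hCD : C ≤ D) :
    euclideanDual h D ≤ euclideanDual h C :=
  fun _ hx y hy => hx y (hCD hy)

theorem euclideanDual_sup (h : γ ^ (m + 1) = 0) (C D : Code R γ m N₁ N₂) :
    euclideanDual h (C ⊔ D) = euclideanDual h C ⊓ euclideanDual h D := by
  refine le_antisymm (le_inf (euclideanDual_anti h le_sup_left)
    (euclideanDual_anti h le_sup_right)) ?_
  rintro x ⟨hC, hD⟩ y hy
  obtain ⟨c, hc, d, hd, rfl⟩ := Submodule.mem_sup.1 hy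
  change form h x (c + d) = 0
  rw [map_add, show form h x c = 0 from hC c hc, show form h x d = 0 from hD d hd, add_zero]

theorem le_euclideanDual_euclideanDual (h : γ ^ (m + 1) = 0) (C : Code R γ m N₁ N₂) :
    C ≤ euclideanDual h (euclideanDual h C) := by
  intro x hx y hy
  exact (form_comm h x y).trans (hy x hx)

theorem mem_euclideanDual_span (h : γ ^ (m + 1) = 0) {ι : Type*}
    (z : ι → Ambient R γ m N₁ N₂) (x : Ambient R γ m N₁ N₂) :
    x ∈ euclideanDual h (Submodule.span R (Set.range z)) ↔ ∀ i, form h x (z i) = 0 := by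
  constructor
  · intro hx i
    exact hx _ (Submodule.subset_span ⟨i, rfl⟩)
  · intro hx y hy
    change form h x y = 0
    induction hy using Submodule.span_induction with
    | mem y hy => obtain ⟨i, rfl⟩ := hy; exact hx i
    | zero => simp
    | add a b _ _ ha hb => rw [map_add, ha, hb, add_zero]
    | smul c a _ ha => rw [map_smul, ha, smul_zero]

theorem isSelfDual_of_le (h : γ ^ (m + 1) = 0) {C D : Code R γ m N₁ N₂}
    (hC : IsSelfDual h C) (hD : IsSelfDual h D) (hCD : C ≤ D) : C = D := by
  refine le_antisymm hCD ?_
  have := euclideanDual_anti h hCD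
  rwa [show euclideanDual h D = D from hD.symm, show euclideanDual h C = C from hC.symm] at this

end FormBasics

/-! ### Kernel and image counts for semilinear maps, as needed for reduction to the residue field.
-/

section Semilinear

variable {R S A B : Type*} [Ring R] [Ring S] {σ : R →+* S} [RingHomSurjective σ]
  [AddCommGroup A] [AddCommGroup B] [Module R A] [Module S B]

theorem card_map_mul_card_inf_ker (f : A →ₛₗ[σ] B) (C : Submodule R A) :
    Nat.card (C.map f) * Nat.card (C ⊓ LinearMap.ker f : Submodule R A) = Nat.card C := by
  let g : C →+ B := f.toAddMonoidHom.comp C.subtype.toAddMonoidHom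
  have e1 : g.range ≃ C.map f := Equiv.subtypeEquivRight fun x => by
    simp [g, Submodule.mem_map]
  have e2 : g.ker ≃ (C ⊓ LinearMap.ker f : Submodule R A) :=
    { toFun := fun x => ⟨x.1, x.1.2, x.2⟩
      invFun := fun x => ⟨⟨x.1, x.2.1⟩, x.2.2⟩
      left_inv := fun x => rfl
      right_inv := fun x => rfl }
  rw [← Nat.card_congr e1, ← Nat.card_congr e2, ← AddSubgroup.index_ker, mul_comm,
    AddSubgroup.card_mul_index]

theorem card_top_submodule : Nat.card (⊤ : Submodule R A) = Nat.card A :=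
  Nat.card_congr Submodule.topEquiv.toEquiv

theorem card_fiber (f : A →ₛₗ[σ] B) (C : Submodule R A) {b : B} (hb : b ∈ C.map f) :
    Nat.card {x // x ∈ C ∧ f x = b} = Nat.card (C ⊓ LinearMap.ker f : Submodule R A) := by
  obtain ⟨a, ha, rfl⟩ := hb
  refine Nat.card_congr
    { toFun := fun x => ⟨x.1 - a, C.sub_mem x.2.1 ha, by simp [x.2.2]⟩
      invFun := fun x => ⟨x.1 + a, C.add_mem x.2.1 ha, by
        rw [map_add, LinearMap.mem_ker.1 x.2.2, zero_add]⟩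
      left_inv := fun x => by simp
      right_inv := fun x => by simp }

end Semilinear

/-! ### Arithmetic of a chain ring of nilpotency index three. -/

section ChainRing

variable {R : Type*} [CommRing R] [IsLocalRing R] {γ : R}

theorem residue_eq_zero_iff_exists (hγ : maximalIdeal R = Ideal.span {γ}) (r : R) :
    residue R r = 0 ↔ ∃ s, r = γ * s := by
  rw [residue_eq_zero_iff, hγ, Ideal.mem_span_singleton]
  rfl

theorem residue_gamma (hγ : maximalIdeal R = Ideal.span {γ}) : residue R γ = 0 :=
  (residue_eq_zero_iff_exists hγ γ).2 ⟨1, (mul_one γ).symm⟩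

theorem gamma_sq_mul_eq_zero_iff (hγ : maximalIdeal R = Ideal.span {γ}) (hγ3 : γ ^ (2 + 1) = 0)
    (hγ2 : γ ^ 2 ≠ 0) (r : R) : γ ^ 2 * r = 0 ↔ residue R r = 0 := by
  constructor
  · intro h
    by_contra hr
    obtain ⟨u, rfl⟩ := (residue_ne_zero_iff_isUnit r).1 hr
    exact hγ2 ((Units.mul_left_eq_zero u).1 h)
  · intro h
    obtain ⟨s, rfl⟩ := (residue_eq_zero_iff_exists hγ r).1 h
    linear_combination s * hγ3

theorem gamma_mul_eq_zero_iff (hγ : maximalIdeal R = Ideal.span {γ}) (hγ3 : γ ^ (2 + 1) = 0)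
    (hγ2 : γ ^ 2 ≠ 0) (r : R) : γ * r = 0 ↔ ∃ s, r = γ ^ 2 * s := by
  constructor
  · intro h
    have h0 : residue R r = 0 := by
      rw [← gamma_sq_mul_eq_zero_iff hγ hγ3 hγ2, pow_two, mul_assoc, h, mul_zero]
    obtain ⟨s, rfl⟩ := (residue_eq_zero_iff_exists hγ r).1 h0
    rw [← mul_assoc, ← pow_two, gamma_sq_mul_eq_zero_iff hγ hγ3 hγ2,
      residue_eq_zero_iff_exists hγ] at h
    obtain ⟨s, rfl⟩ := h
    exact ⟨s, by ring⟩
  · rintro ⟨s, rfl⟩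
    linear_combination s * hγ3

/-- A nonzero element is a unit times 1, γ or γ². This says that γ² generates a simple essential
socle, the input for the duality of cardinalities. -/
theorem exists_mul_eq_gamma_sq (hγ : maximalIdeal R = Ideal.span {γ}) (hγ3 : γ ^ (2 + 1) = 0)
    (r : R) (hr : r ≠ 0) : ∃ t, t * r = γ ^ 2 := by
  have key (u : R) : residue R u = 0 ∨ ∃ v, v * u = 1 := by
    by_cases h : residue R u = 0
    · exact Or.inl h
    · obtain ⟨u, rfl⟩ := (residue_ne_zero_iff_isUnit u).1 h
      exact Or.inr ⟨_, u.inv_mul⟩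
  rcases key r with h | ⟨v, hv⟩
  swap
  · exact ⟨γ ^ 2 * v, by linear_combination γ ^ 2 * hv⟩
  obtain ⟨s, rfl⟩ := (residue_eq_zero_iff_exists hγ r).1 h
  rcases key s with h | ⟨v, hv⟩
  swap
  · exact ⟨γ * v, by linear_combination γ ^ 2 * hv⟩
  obtain ⟨s, rfl⟩ := (residue_eq_zero_iff_exists hγ s).1 h
  rcases key s with h | ⟨v, hv⟩
  swap
  · exact ⟨v, by linear_combination γ ^ 2 * hv⟩
  obtain ⟨s, rfl⟩ := (residue_eq_zero_iff_exists hγ s).1 h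
  exact absurd (by linear_combination s * hγ3) hr

/-- If 2 were a multiple of γ then 8 = 0, and an odd characteristic dividing 8 is 1. -/
theorem residue_two_ne_zero (hγ : maximalIdeal R = Ideal.span {γ}) (hγ3 : γ ^ (2 + 1) = 0)
    (hodd : Odd (ringChar R)) : (2 : ResidueField R) ≠ 0 := by
  intro h
  obtain ⟨s, hs⟩ := (residue_eq_zero_iff_exists hγ 2).1 ((map_ofNat (residue R) 2).trans h)
  have hd : ringChar R ∣ 2 ^ 3 := by
    apply ringChar.dvd
    rw [Nat.cast_pow, Nat.cast_ofNat, hs]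
    linear_combination s ^ 3 * hγ3
  obtain ⟨j, -, hj⟩ := (Nat.dvd_prime_pow Nat.prime_two).1 hd
  have : ringChar R = 1 := by
    rcases j with _ | j
    · simpa using hj
    · rw [hj, pow_succ] at hodd
      exact absurd hodd (Nat.not_odd_iff_even.2 (even_two.mul_left _))
  exact one_ne_zero (α := R) (by simpa [this] using ringChar.Nat.cast_ringChar (R := R))

instance [Finite R] : Finite (ResidueField R) :=
  Finite.of_surjective (residue R) residue_surjective

theorem card_gamma_torsion [Finite R] (hγ : maximalIdeal R = Ideal.span {γ})
    (hγ3 : γ ^ (2 + 1) = 0) (hγ2 : γ ^ 2 ≠ 0) :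
    Nat.card (LinearMap.ker (LinearMap.mulLeft R γ)) = Nat.card (ResidueField R) := by
  have e : LinearMap.ker (LinearMap.mulLeft R γ) = (⊤ : Submodule R R).map
      (LinearMap.mulLeft R (γ ^ 2)) := by
    ext r
    simp [gamma_mul_eq_zero_iff hγ hγ3 hγ2, eq_comm]
  have h1 := card_map_mul_card_inf_ker (LinearMap.mulLeft R (γ ^ 2)) ⊤
  have h2 := card_map_mul_card_inf_ker
    (Algebra.linearMap R (ResidueField R)) ⊤
  have hk : LinearMap.ker (LinearMap.mulLeft R (γ ^ 2)) =
      LinearMap.ker (Algebra.linearMap R (ResidueField R)) := by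
    ext r
    exact gamma_sq_mul_eq_zero_iff hγ hγ3 hγ2 r
  have hs : (⊤ : Submodule R R).map (Algebra.linearMap R (ResidueField R)) = ⊤ := by
    rw [Submodule.map_top, LinearMap.range_eq_top]
    exact residue_surjective
  rw [hs, ← h1, hk, top_inf_eq, card_top_submodule] at h2
  rw [e]
  exact (Nat.eq_of_mul_eq_mul_right Nat.card_pos h2).symm

theorem card_eq_cube [Finite R] (hγ : maximalIdeal R = Ideal.span {γ})
    (hγ3 : γ ^ (2 + 1) = 0) (hγ2 : γ ^ 2 ≠ 0) :
    Nat.card R = Nat.card (ResidueField R) ^ 3 := by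
  have hP := card_gamma_torsion hγ hγ3 hγ2
  have h1 := card_map_mul_card_inf_ker (LinearMap.mulLeft R γ) ⊤
  have h2 := card_map_mul_card_inf_ker (LinearMap.mulLeft R γ)
    ((⊤ : Submodule R R).map (LinearMap.mulLeft R γ))
  have e1 : ((⊤ : Submodule R R).map (LinearMap.mulLeft R γ)).map (LinearMap.mulLeft R γ) =
      LinearMap.ker (LinearMap.mulLeft R γ) := by
    ext r
    simp [gamma_mul_eq_zero_iff hγ hγ3 hγ2, eq_comm, pow_two, mul_assoc]
  have e2 : (⊤ : Submodule R R).map (LinearMap.mulLeft R γ) ⊓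
      LinearMap.ker (LinearMap.mulLeft R γ) = LinearMap.ker (LinearMap.mulLeft R γ) := by
    rw [inf_eq_right]
    intro r hr
    obtain ⟨s, rfl⟩ := (gamma_mul_eq_zero_iff hγ hγ3 hγ2 r).1 hr
    exact ⟨γ * s, trivial, by simp [pow_two, mul_assoc]⟩
  rw [e1, e2, hP] at h2
  rw [top_inf_eq, hP, ← h2, card_top_submodule] at h1
  rw [← h1]
  ring

theorem card_quotient_eq_sq [Finite R] (hγ : maximalIdeal R = Ideal.span {γ})
    (hγ3 : γ ^ (2 + 1) = 0) (hγ2 : γ ^ 2 ≠ 0) :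
    Nat.card (R ⧸ Ideal.span {γ ^ 2}) = Nat.card (ResidueField R) ^ 2 := by
  have hP := card_gamma_torsion hγ hγ3 hγ2
  have e : LinearMap.ker (LinearMap.mulLeft R γ) = Ideal.span {γ ^ 2} := by
    ext r
    rw [Ideal.mem_span_singleton]
    exact gamma_mul_eq_zero_iff hγ hγ3 hγ2 r
  have h := Submodule.card_eq_card_quotient_mul_card (Ideal.span {γ ^ 2})
  rw [← e, hP, card_eq_cube hγ hγ3 hγ2, e, pow_succ _ 2] at h
  exact (Nat.eq_of_mul_eq_mul_right Nat.card_pos (by rw [h, mul_comm])).symm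

end ChainRing

/-- `γ` generates the maximal ideal and has nilpotency index three. -/
structure IsUniformizer {R : Type*} [CommRing R] [IsLocalRing R] (γ : R) : Prop where
  max : maximalIdeal R = Ideal.span {γ}
  cube : γ ^ (2 + 1) = 0
  sq : γ ^ 2 ≠ 0

/-! ### Reductions of words and the leading terms of the form. -/

section Residues

variable {R : Type*} [CommRing R] [IsLocalRing R] {γ : R} {N₁ N₂ : ℕ}

instance : RingHomSurjective (residue R) := ⟨residue_surjective⟩

/-- Reduction of the first block modulo the maximal ideal. -/
def res₁ : Ambient R γ 2 N₁ N₂ →ₛₗ[residue R] (Fin N₁ → ResidueField R) where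
  toFun x i := residue R (x.1 i)
  map_add' x y := by ext; simp
  map_smul' r x := by ext; simp

/-- Reduction of the second block modulo the maximal ideal. -/
def res₂ (h : IsUniformizer γ) :
    Ambient R γ 2 N₁ N₂ →ₛₗ[residue R] (Fin N₂ → ResidueField R) where
  toFun x j := Ideal.Quotient.lift (Ideal.span {γ ^ 2}) (residue R) (fun a ha => by
    obtain ⟨b, rfl⟩ := Ideal.mem_span_singleton'.1 ha
    rw [map_mul, map_pow, residue_gamma h.max, zero_pow two_ne_zero, mul_zero]) (x.2 j)
  map_add' x y := by ext; simp
  map_smul' r x := by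
    ext j
    obtain ⟨s, hs⟩ := Ideal.Quotient.mk_surjective (x.2 j)
    simp only [Prod.smul_snd, Pi.smul_apply, ← hs, smul_eq_mul]
    rw [← Ideal.Quotient.mk_eq_mk, ← Submodule.Quotient.mk_smul, Ideal.Quotient.mk_eq_mk]
    simp

theorem res₁_word (c : Fin N₁ → R) (d : Fin N₂ → R) :
    res₁ (word γ 2 c d) = fun i => residue R (c i) := rfl

theorem res₂_word (h : IsUniformizer γ) (c : Fin N₁ → R) (d : Fin N₂ → R) :
    res₂ h (word γ 2 c d) = fun i => residue R (d i) := rfl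

theorem residue_dotProduct {n : ℕ} (c d : Fin n → R) :
    residue R (c ⬝ᵥ d) = (fun i => residue R (c i)) ⬝ᵥ fun i => residue R (d i) := by
  simp [dotProduct]

theorem exists_res_eq (h : IsUniformizer γ) (a : Fin N₁ → ResidueField R)
    (b : Fin N₂ → ResidueField R) :
    ∃ x : Ambient R γ 2 N₁ N₂, res₁ x = a ∧ res₂ h x = b := by
  choose c hc using fun i => residue_surjective (R := R) (a i)
  choose d hd using fun i => residue_surjective (R := R) (b i)
  exact ⟨word γ 2 c d, funext hc, funext hd⟩

variable (h : IsUniformizer γ) (x y : Ambient R γ 2 N₁ N₂)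
include h

theorem residue_form : residue R (form h.cube x y) = res₁ x ⬝ᵥ res₁ y := by
  obtain ⟨c, d, rfl⟩ := exists_word x
  obtain ⟨c', d', rfl⟩ := exists_word y
  rw [form_word, map_add, map_mul, residue_gamma h.max, zero_mul, add_zero, residue_dotProduct,
    res₁_word, res₁_word]

theorem res₁_eq_zero_iff : res₁ x = 0 ↔ ∃ u d, x = word γ 2 (γ • u) d := by
  constructor
  · intro hx
    obtain ⟨c, d, rfl⟩ := exists_word x
    choose u hu using fun i => (residue_eq_zero_iff_exists h.max (c i)).1 (congrFun hx i)
    exact ⟨u, d, by rw [show c = γ • u from funext hu]⟩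
  · rintro ⟨u, d, rfl⟩
    ext i
    simp [res₁_word, residue_gamma h.max]

theorem res_eq_zero_iff : res₁ x = 0 ∧ res₂ h x = 0 ↔ ∃ y, x = γ • y := by
  constructor
  · rintro ⟨h1, h2⟩
    obtain ⟨u, d, rfl⟩ := (res₁_eq_zero_iff h x).1 h1
    choose e he using fun i => (residue_eq_zero_iff_exists h.max (d i)).1 (congrFun h2 i)
    exact ⟨word γ 2 u e, by rw [show d = γ • e from funext he, smul_word]⟩
  · rintro ⟨y, rfl⟩
    rw [LinearMap.map_smulₛₗ, LinearMap.map_smulₛₗ, residue_gamma h.max, zero_smul, zero_smul]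
    exact ⟨rfl, rfl⟩

/-- The torsion is γ²R in the first block but γR/γ²R in the second; the condition on `res₁ y`
supplies the additional factor γ in the first block only. -/
theorem gamma_smul_eq_zero_iff : γ • x = 0 ↔ ∃ y, res₁ y = 0 ∧ x = γ • y := by
  constructor
  · intro hx
    obtain ⟨c, d, rfl⟩ := exists_word x
    rw [smul_word] at hx
    choose u hu using fun i => (gamma_mul_eq_zero_iff h.max h.cube h.sq (c i)).1
      (congrFun (congrArg Prod.fst hx) i)
    have hd (j : Fin N₂) : ∃ e, d j = γ * e := by
      have := congrFun (congrArg Prod.snd hx) j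
      have := Ideal.mem_span_singleton.1 (Ideal.Quotient.eq_zero_iff_mem.1 this)
      obtain ⟨t, ht⟩ := this
      have ht : γ * d j = γ ^ 2 * t := ht
      obtain ⟨s, hs⟩ := (gamma_mul_eq_zero_iff h.max h.cube h.sq (d j - γ * t)).1 (by
        linear_combination ht)
      exact ⟨t + γ * s, by linear_combination hs⟩
    choose e he using hd
    refine ⟨word γ 2 (γ • u) e, (res₁_eq_zero_iff h _).2 ⟨_, _, rfl⟩, ?_⟩
    rw [smul_word, show d = γ • e from funext he, smul_smul, ← pow_two,
      show c = γ ^ 2 • u from funext hu]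
  · rintro ⟨y, hy, rfl⟩
    obtain ⟨u, d, rfl⟩ := (res₁_eq_zero_iff h y).1 hy
    rw [smul_word, smul_word]
    refine Prod.ext ?_ ?_
    · ext i
      change γ * (γ * (γ * u i)) = 0
      linear_combination u i * h.cube
    · ext j
      refine Ideal.Quotient.eq_zero_iff_mem.2 (Ideal.mem_span_singleton.2 ⟨d j, ?_⟩)
      change γ * (γ * d j) = _
      ring

/-- With first block γu, the form is γ(u·c' + d·d'), and u·c' disappears modulo γ once `res₁ y = 0`.
On such words the leading term is thus the dot product of the second blocks. -/
theorem exists_form_eq_of_res₁_eq_zero (hx : res₁ x = 0) : ∃ r, form h.cube x y = γ * r ∧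
    (res₁ y = 0 → residue R r = res₂ h x ⬝ᵥ res₂ h y) := by
  obtain ⟨u, d, rfl⟩ := (res₁_eq_zero_iff h x).1 hx
  obtain ⟨c', d', rfl⟩ := exists_word y
  refine ⟨u ⬝ᵥ c' + d ⬝ᵥ d', ?_, fun hy => ?_⟩
  · rw [form_word, smul_dotProduct, smul_eq_mul]
    ring
  · rw [map_add, residue_dotProduct, residue_dotProduct, ← res₁_word (γ := γ) c' d', hy,
      res₂_word, res₂_word, dotProduct_zero, zero_add]

theorem eq_zero_of_form_eq_zero (hx : ∀ y, form h.cube x y = 0) : x = 0 := by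
  classical
  obtain ⟨c, d, rfl⟩ := exists_word x
  refine Prod.ext ?_ ?_
  · ext i
    have := hx (word γ 2 (Pi.single i 1) 0)
    rw [form_word] at this
    change c i = 0
    simpa using this
  · ext j
    have := hx (word γ 2 0 (Pi.single j 1))
    rw [form_word] at this
    obtain ⟨s, hs⟩ := (gamma_mul_eq_zero_iff h.max h.cube h.sq (d j)).1 (by simpa using this)
    exact Ideal.Quotient.eq_zero_iff_mem.2 (Ideal.mem_span_singleton.2 ⟨s, hs⟩)

theorem form_smul_smul_eq_zero_iff :
    form h.cube (γ • x) (γ • y) = 0 ↔ res₁ x ⬝ᵥ res₁ y = 0 := by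
  rw [← residue_form h, ← gamma_sq_mul_eq_zero_iff h.max h.cube h.sq, map_smul,
    map_smul, LinearMap.smul_apply, smul_smul, ← pow_two, smul_eq_mul]

end Residues

/-! ### Double duals and cardinalities over a finite chain ring. -/

section Duality

instance {R : Type*} [CommRing R] [Finite R] (I : Ideal R) : Finite (R ⧸ I) :=
  Finite.of_surjective _ Ideal.Quotient.mk_surjective

variable {R : Type*} [CommRing R] [IsLocalRing R] [Finite R] {γ : R} {N₁ N₂ : ℕ}
  (h : IsUniformizer γ) (C D : Code R γ 2 N₁ N₂)
include h

theorem card_mul_card_euclideanDual :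
    Nat.card C * Nat.card (euclideanDual h.cube C) = Nat.card (Ambient R γ 2 N₁ N₂) := by
  rw [euclideanDual_eq]
  exact card_mul_card_orthogonal (form h.cube) (γ ^ 2) h.sq
    (exists_mul_eq_gamma_sq h.max h.cube) (eq_zero_of_form_eq_zero h) C

theorem euclideanDual_euclideanDual : euclideanDual h.cube (euclideanDual h.cube C) = C := by
  symm
  apply SetLike.coe_injective
  apply Set.eq_of_subset_of_ncard_le (le_euclideanDual_euclideanDual h.cube C) _ (Set.toFinite _)
  have h1 := card_mul_card_euclideanDual h C
  rw [← card_mul_card_euclideanDual h (euclideanDual h.cube C), mul_comm] at h1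
  exact (Nat.eq_of_mul_eq_mul_left Nat.card_pos h1).ge

theorem euclideanDual_inf : euclideanDual h.cube (C ⊓ D) =
    euclideanDual h.cube C ⊔ euclideanDual h.cube D := by
  rw [← euclideanDual_euclideanDual h (_ ⊔ _), euclideanDual_sup, euclideanDual_euclideanDual h,
    euclideanDual_euclideanDual h]

theorem card_ambient : Nat.card (Ambient R γ 2 N₁ N₂) =
    Nat.card (ResidueField R) ^ (3 * N₁ + 2 * N₂) := by
  rw [Nat.card_prod, Nat.card_fun, Nat.card_fun, card_eq_cube h.max h.cube h.sq,
    card_quotient_eq_sq h.max h.cube h.sq]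
  simp [pow_add, pow_mul]

/-- The neighbour of a self-dual code along an isotropic subcode. -/
theorem isSelfDual_sup_inf {Z : Code R γ 2 N₁ N₂} (hZ : Z ≤ euclideanDual h.cube Z)
    (hD : IsSelfDual h.cube D) : IsSelfDual h.cube (Z ⊔ D ⊓ euclideanDual h.cube Z) := by
  -- The dual is Z^⊥ ∩ (D + Z), and the modular law for Z ≤ Z^⊥ rewrites it as Z + (D ∩ Z^⊥).
  rw [IsSelfDual, euclideanDual_sup, euclideanDual_inf h, euclideanDual_euclideanDual h,
    show euclideanDual h.cube D = D from hD.symm, ← sup_inf_assoc_of_le D hZ, inf_comm, sup_comm]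

end Duality

/-! ### The torsion and residue codes of a self-dual code. -/

section Types

variable {R : Type*} [CommRing R] [IsLocalRing R] {γ : R} {N₁ N₂ : ℕ}

/-- The residue code of the first block. -/
def resCode (C : Code R γ 2 N₁ N₂) : Submodule (ResidueField R) (Fin N₁ → ResidueField R) :=
  C.map res₁

/-- The first torsion code of the first block. -/
def torCode (C : Code R γ 2 N₁ N₂) : Submodule (ResidueField R) (Fin N₁ → ResidueField R) :=
  (C.comap (LinearMap.lsmul R (Ambient R γ 2 N₁ N₂) γ)).map res₁

/-- The residue code of the second block, for words vanishing on the first block modulo `γ`. -/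
def resCode₂ (h : IsUniformizer γ) (C : Code R γ 2 N₁ N₂) :
    Submodule (ResidueField R) (Fin N₂ → ResidueField R) :=
  (C ⊓ LinearMap.ker res₁).map (res₂ h)

/-- The code of all multiples by `γ` of words whose reduction lies in `T`. -/
def baseCode (γ : R) (N₂ : ℕ) (T : Submodule (ResidueField R) (Fin N₁ → ResidueField R)) :
    Code R γ 2 N₁ N₂ :=
  (T.comap res₁).map (LinearMap.lsmul R (Ambient R γ 2 N₁ N₂) γ)

theorem mem_torCode {C : Code R γ 2 N₁ N₂} {a : Fin N₁ → ResidueField R} :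
    a ∈ torCode C ↔ ∃ x, γ • x ∈ C ∧ res₁ x = a := Iff.rfl

theorem resCode_le_torCode (C : Code R γ 2 N₁ N₂) : resCode C ≤ torCode C := by
  rintro _ ⟨x, hx, rfl⟩
  exact ⟨x, C.smul_mem γ hx, rfl⟩

variable (h : IsUniformizer γ) {C : Code R γ 2 N₁ N₂}
include h

/-- On words with `res₁ = 0` the form is γr with r reducing to the dot product of second blocks, and
γr = 0 makes r a multiple of γ². -/
theorem resCode₂_le_orthogonal (hC : IsSelfDual h.cube C) :
    resCode₂ h C ≤ (resCode₂ h C).orthogonalBilin (dotProductBilin _ _) := by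
  rintro _ ⟨x, ⟨hxC, hx⟩, rfl⟩
  rw [Submodule.mem_orthogonalBilin_iff]
  rintro _ ⟨y, ⟨hyC, hy⟩, rfl⟩
  obtain ⟨r, hr, hres⟩ := exists_form_eq_of_res₁_eq_zero h y x hy
  change res₂ h y ⬝ᵥ res₂ h x = 0
  rw [← hres hx]
  rw [hC] at hyC
  rw [show form h.cube y x = 0 from hyC x hxC] at hr
  obtain ⟨s, rfl⟩ := (gamma_mul_eq_zero_iff h.max h.cube h.sq r).1 hr.symm
  rw [map_mul, map_pow, residue_gamma h.max]
  simp

theorem isSelfDual_baseCode {T : Submodule (ResidueField R) (Fin N₁ → ResidueField R)}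
    (hT : T = T.orthogonalBilin (dotProductBilin _ _)) :
    IsSelfDual h.cube (baseCode γ N₂ T) := by
  apply le_antisymm
  · rintro _ ⟨x, hx, rfl⟩ _ ⟨y, hy, rfl⟩
    refine (form_smul_smul_eq_zero_iff h x y).2 ?_
    rw [SetLike.mem_coe, Submodule.mem_comap, hT, Submodule.mem_orthogonalBilin_iff] at hx
    rw [dotProduct_comm]
    exact hx _ hy
  · intro x hx
    have hx (y) (hy : res₁ y ∈ T) : form h.cube x (γ • y) = 0 := hx _ ⟨y, hy, rfl⟩
    -- Three kinds of test words: γ²y with y arbitrary kills `res₁ x`; γy with `res₁ y = 0` kills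
    -- `res₂ x`; γy with `res₁ y` in T then places x/γ over T^⊥ = T.
    have h1 : res₁ x = 0 := by
      apply dotProduct_eq_zero
      intro a
      obtain ⟨y, hy, -⟩ := exists_res_eq h a (0 : Fin N₂ → ResidueField R)
      have := hx (γ • y) (by
        rw [LinearMap.map_smulₛₗ, residue_gamma h.max, zero_smul]; exact T.zero_mem)
      rw [map_smul, map_smul, smul_smul, ← pow_two, smul_eq_mul,
        gamma_sq_mul_eq_zero_iff h.max h.cube h.sq, residue_form h, hy] at this
      exact this
    have h2 : res₂ h x = 0 := by
      apply dotProduct_eq_zero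
      intro b
      obtain ⟨y, hy, hyb⟩ := exists_res_eq h (0 : Fin N₁ → ResidueField R) b
      have := hx y (by rw [hy]; exact T.zero_mem)
      obtain ⟨r, hr, hres⟩ := exists_form_eq_of_res₁_eq_zero h x y h1
      rw [map_smul, hr, smul_eq_mul, ← mul_assoc, ← pow_two,
        gamma_sq_mul_eq_zero_iff h.max h.cube h.sq, hres hy, hyb] at this
      exact this
    obtain ⟨x, rfl⟩ := (res_eq_zero_iff h x).1 ⟨h1, h2⟩
    refine ⟨x, ?_, rfl⟩
    rw [SetLike.mem_coe, Submodule.mem_comap, hT, Submodule.mem_orthogonalBilin_iff]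
    intro a ha
    obtain ⟨y, hy, -⟩ := exists_res_eq h a (0 : Fin N₂ → ResidueField R)
    have := (form_smul_smul_eq_zero_iff h x y).1 (hx y (hy ▸ ha))
    rw [← hy]
    exact (dotProduct_comm _ _).trans this

/-- On multiples of γ the form is γ² times the dot product of residues, so T ≤ T^⊥. For maximality,
(C ∩ γA)^⊥ = C + (γA)^⊥ with A the ambient module, and (γA)^⊥ is the γ-torsion, which does not
affect the reduction after division by γ. -/
theorem torCode_eq_orthogonal [Finite R] (hC : IsSelfDual h.cube C) :
    torCode C = (torCode C).orthogonalBilin (dotProductBilin _ _) := by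
  apply le_antisymm
  · rintro _ ⟨x, hx, rfl⟩
    rw [Submodule.mem_orthogonalBilin_iff]
    rintro _ ⟨y, hy, rfl⟩
    refine (form_smul_smul_eq_zero_iff h y x).1 ?_
    have hy : γ • y ∈ C := hy
    rw [hC] at hy
    exact hy _ hx
  · intro a ha
    rw [Submodule.mem_orthogonalBilin_iff] at ha
    obtain ⟨x, hx, -⟩ := exists_res_eq h a (0 : Fin N₂ → ResidueField R)
    let G : Code R γ 2 N₁ N₂ := (⊤ : Code R γ 2 N₁ N₂).map
      (LinearMap.lsmul R (Ambient R γ 2 N₁ N₂) γ)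
    have hmem : γ • x ∈ euclideanDual h.cube (C ⊓ G) := by
      rintro _ ⟨hyC, y, -, rfl⟩
      refine (form_smul_smul_eq_zero_iff h x y).2 ?_
      rw [hx, dotProduct_comm]
      exact ha _ ⟨y, hyC, rfl⟩
    rw [euclideanDual_inf h, show euclideanDual h.cube C = C from hC.symm] at hmem
    obtain ⟨c, hc, y, hy, hcy⟩ := Submodule.mem_sup.1 hmem
    have hy0 : γ • y = 0 := by
      apply eq_zero_of_form_eq_zero h
      intro w
      have := hy _ ⟨w, trivial, rfl⟩
      change form h.cube y (γ • w) = 0 at this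
      rwa [map_smul, ← LinearMap.smul_apply, ← map_smul] at this
    obtain ⟨w, hw, rfl⟩ := (gamma_smul_eq_zero_iff h y).1 hy0
    refine mem_torCode.2 ⟨x - w, ?_, ?_⟩
    · rw [smul_sub, ← hcy, add_sub_cancel_right]
      exact hc
    · rw [map_sub, hw, hx, sub_zero]

end Types

/-! ### The unique code of given type through an isotropic lift. -/

section Neighbours

variable {R : Type*} [CommRing R] [IsLocalRing R] {γ : R} {N₁ N₂ : ℕ}
  (h : IsUniformizer γ) {k l : ℕ} (t : Fin k → Fin N₁ → ResidueField R)
  (e : Fin l → Fin N₂ → ResidueField R)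

/-- A family of words lifting the families `t` and `e`. -/
def IsLift (z : Fin k ⊕ Fin l → Ambient R γ 2 N₁ N₂) : Prop :=
  (∀ i, res₁ (z (Sum.inl i)) = t i) ∧
    ∀ j, res₁ (z (Sum.inr j)) = 0 ∧ res₂ h (z (Sum.inr j)) = e j

/-- The self-dual codes with prescribed residue and torsion codes. -/
def HasType (T T₀ : Submodule (ResidueField R) (Fin N₁ → ResidueField R))
    (Q : Submodule (ResidueField R) (Fin N₂ → ResidueField R)) (C : Code R γ 2 N₁ N₂) : Prop :=
  IsSelfDual h.cube C ∧ torCode C = T ∧ resCode C = T₀ ∧ resCode₂ h C = Q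

variable {t e} {z : Fin k ⊕ Fin l → Ambient R γ 2 N₁ N₂} (hz : IsLift h t e z)
include hz

theorem res₁_sum_lift (c : Fin k ⊕ Fin l → R) :
    res₁ (∑ a, c a • z a) = ∑ i, residue R (c (Sum.inl i)) • t i := by
  simp [Fintype.sum_sum_type, hz.1, hz.2]

theorem res₂_sum_lift (c : Fin k ⊕ Fin l → R) (hc : ∀ i, residue R (c (Sum.inl i)) = 0) :
    res₂ h (∑ a, c a • z a) = ∑ j, residue R (c (Sum.inr j)) • e j := by
  simp [Fintype.sum_sum_type, hz.2, hc]

theorem residue_eq_zero_of_res₁_sum_lift (ht : LinearIndependent (ResidueField R) t)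
    (c : Fin k ⊕ Fin l → R) (hc : res₁ (∑ a, c a • z a) = 0) (i : Fin k) :
    residue R (c (Sum.inl i)) = 0 := by
  rw [res₁_sum_lift h hz] at hc
  exact Fintype.linearIndependent_iff.1 ht _ hc i

theorem resCode_span_lift :
    (Submodule.span R (Set.range z)).map res₁ = Submodule.span (ResidueField R) (Set.range t) := by
  apply le_antisymm
  · rintro _ ⟨x, hx, rfl⟩
    obtain ⟨c, rfl⟩ := (Submodule.mem_span_range_iff_exists_fun R).1 hx
    rw [res₁_sum_lift h hz]
    exact (Submodule.mem_span_range_iff_exists_fun _).2 ⟨_, rfl⟩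
  · rw [Submodule.span_le]
    rintro _ ⟨i, rfl⟩
    exact ⟨z (Sum.inl i), Submodule.subset_span ⟨_, rfl⟩, hz.1 i⟩

variable {T : Submodule (ResidueField R) (Fin N₁ → ResidueField R)}

/-- Subtracting combinations of the lift first removes `res₁`, then `res₂`; what is left is a
multiple of γ in C, hence in the base code and orthogonal to the lift. -/
theorem le_neighbour {C : Code R γ 2 N₁ N₂}
    (hC : HasType h T (Submodule.span _ (Set.range t)) (Submodule.span _ (Set.range e)) C)
    (hzC : ∀ a, z a ∈ C) :
    C ≤ Submodule.span R (Set.range z) ⊔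
      baseCode γ N₂ T ⊓ euclideanDual h.cube (Submodule.span R (Set.range z)) := by
  intro x hx
  obtain ⟨hsd, hT, hT₀, hQ⟩ := hC
  have hspan : Submodule.span R (Set.range z) ≤ C := by
    rw [Submodule.span_le]
    rintro _ ⟨a, rfl⟩
    exact hzC a
  have h1 : res₁ x ∈ resCode C := ⟨x, hx, rfl⟩
  rw [hT₀, ← resCode_span_lift h hz] at h1
  obtain ⟨x', hx', hres⟩ := h1
  have h2 : res₂ h (x - x') ∈ resCode₂ h C :=
    ⟨x - x', ⟨C.sub_mem hx (hspan hx'), by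
      rw [SetLike.mem_coe, LinearMap.mem_ker, map_sub, hres, sub_self]⟩, rfl⟩
  rw [hQ] at h2
  obtain ⟨b, hb⟩ := (Submodule.mem_span_range_iff_exists_fun _).1 h2
  choose c hc using fun j => residue_surjective (R := R) (b j)
  let c' : Fin k ⊕ Fin l → R := Sum.elim 0 c
  have hx'' : ∑ a, c' a • z a ∈ Submodule.span R (Set.range z) :=
    (Submodule.mem_span_range_iff_exists_fun R).2 ⟨c', rfl⟩
  obtain ⟨y, hy⟩ := (res_eq_zero_iff h (x - x' - ∑ a, c' a • z a)).1 (by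
    constructor
    · rw [map_sub, map_sub, hres, sub_self, res₁_sum_lift h hz]
      simp [c']
    · rw [map_sub, ← hb, res₂_sum_lift h hz _ (by simp [c'])]
      simp [c', hc])
  have hyC : γ • y ∈ C := hy ▸ C.sub_mem (C.sub_mem hx (hspan hx')) (hspan hx'')
  refine Submodule.mem_sup.2 ⟨x' + ∑ a, c' a • z a, Submodule.add_mem _ hx' hx'', γ • y,
    ⟨⟨y, ?_, rfl⟩, ?_⟩, by rw [← hy]; abel⟩
  · rw [SetLike.mem_coe, Submodule.mem_comap, ← hT]
    exact ⟨y, hyC, rfl⟩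
  · rw [hsd] at hyC
    exact euclideanDual_anti h.cube hspan hyC

theorem hasType_neighbour [Finite R] (ht : LinearIndependent (ResidueField R) t)
    (he : LinearIndependent (ResidueField R) e)
    (hT : T = T.orthogonalBilin (dotProductBilin _ _))
    (htT : Submodule.span _ (Set.range t) ≤ T) (hiso : ∀ a b, form h.cube (z a) (z b) = 0) :
    HasType h T (Submodule.span _ (Set.range t)) (Submodule.span _ (Set.range e))
      (Submodule.span R (Set.range z) ⊔
        baseCode γ N₂ T ⊓ euclideanDual h.cube (Submodule.span R (Set.range z))) := by
  set Z := Submodule.span R (Set.range z) with hZdef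
  have hZ : Z ≤ euclideanDual h.cube Z := by
    rw [hZdef, Submodule.span_le]
    rintro _ ⟨a, rfl⟩
    exact (mem_euclideanDual_span h.cube z _).2 (hiso a)
  have hres {x} (hx : x ∈ baseCode γ N₂ T) : res₁ x = 0 ∧ res₂ h x = 0 := by
    obtain ⟨y, -, rfl⟩ := hx
    exact (res_eq_zero_iff h _).2 ⟨y, rfl⟩
  have hsd := isSelfDual_sup_inf h _ hZ (isSelfDual_baseCode (N₂ := N₂) h hT)
  refine ⟨hsd, ?_, ?_, ?_⟩
  · have hle : torCode (Z ⊔ baseCode γ N₂ T ⊓ euclideanDual h.cube Z) ≤ T := by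
      rintro _ ⟨x, hx, rfl⟩
      obtain ⟨y, hy, w, ⟨hw, -⟩, hyw⟩ := Submodule.mem_sup.1 hx
      replace hyw : y + w = γ • x := hyw
      obtain ⟨hw1, hw2⟩ := hres hw
      obtain ⟨w, hwT, rfl⟩ := hw
      obtain ⟨hx1, hx2⟩ := (res_eq_zero_iff h (γ • x)).2 ⟨x, rfl⟩
      obtain ⟨c, rfl⟩ := (Submodule.mem_span_range_iff_exists_fun R).1 hy
      have hc1 := residue_eq_zero_of_res₁_sum_lift h hz ht c (by
        rw [← hyw, map_add, hw1, add_zero] at hx1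
        exact hx1)
      have hc2 (j) : residue R (c (Sum.inr j)) = 0 := by
        rw [← hyw, map_add, hw2, add_zero, res₂_sum_lift h hz c hc1] at hx2
        exact Fintype.linearIndependent_iff.1 he _ hx2 j
      have hc (a) : residue R (c a) = 0 := by
        rcases a with i | j
        · exact hc1 i
        · exact hc2 j
      -- Independence of `t` and `e` has made every coefficient divisible by γ, so the equation can
      -- be divided by γ up to torsion, on which `res₁` vanishes.
      choose c' hc' using fun a => (residue_eq_zero_iff_exists h.max (c a)).1 (hc a)
      have hsum : ∑ a, c a • z a = γ • ∑ a, c' a • z a := by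
        rw [Finset.smul_sum]
        refine Finset.sum_congr rfl fun a _ => ?_
        rw [hc', mul_smul]
      have h0 : γ • (x - ∑ a, c' a • z a - w) = 0 := by
        rw [smul_sub, smul_sub, ← hyw, hsum, LinearMap.lsmul_apply]
        abel
      obtain ⟨v, hv, hxv⟩ := (gamma_smul_eq_zero_iff h _).1 h0
      have h1 : res₁ (x - ∑ a, c' a • z a - w) = 0 := by
        rw [hxv]
        exact ((res_eq_zero_iff h _).2 ⟨v, rfl⟩).1
      rw [map_sub, map_sub, sub_sub, sub_eq_zero] at h1
      rw [h1]
      refine T.add_mem (htT ?_) hwT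
      rw [← resCode_span_lift h hz]
      exact ⟨_, (Submodule.mem_span_range_iff_exists_fun R).2 ⟨c', rfl⟩, rfl⟩
    -- Both codes equal their own orthogonals, so dualizing one inclusion gives the other.
    refine le_antisymm hle ?_
    rw [torCode_eq_orthogonal h hsd]
    conv_lhs => rw [hT]
    exact Submodule.orthogonalBilin_le hle
  · rw [resCode, Submodule.map_sup, resCode_span_lift h hz, sup_eq_left]
    rintro _ ⟨x, ⟨hx, -⟩, rfl⟩
    rw [(hres hx).1]
    exact Submodule.zero_mem _
  · apply le_antisymm
    · rintro _ ⟨x, ⟨hx, hx1⟩, rfl⟩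
      obtain ⟨y, hy, w, ⟨hw, -⟩, rfl⟩ := Submodule.mem_sup.1 hx
      rw [SetLike.mem_coe, LinearMap.mem_ker, map_add, (hres hw).1, add_zero] at hx1
      obtain ⟨c, rfl⟩ := (Submodule.mem_span_range_iff_exists_fun R).1 hy
      rw [map_add, (hres hw).2, add_zero, res₂_sum_lift h hz c
        (residue_eq_zero_of_res₁_sum_lift h hz ht c hx1)]
      exact (Submodule.mem_span_range_iff_exists_fun _).2 ⟨_, rfl⟩
    · rw [Submodule.span_le]
      rintro _ ⟨j, rfl⟩
      exact ⟨z (Sum.inr j), ⟨le_sup_left (a := Z) (Submodule.subset_span ⟨_, rfl⟩), (hz.2 j).1⟩,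
        (hz.2 j).2⟩

/-- Uniqueness holds because any such code lies inside the neighbour, and nested self-dual codes
coincide. -/
theorem existsUnique_neighbour [Finite R] (ht : LinearIndependent (ResidueField R) t)
    (he : LinearIndependent (ResidueField R) e)
    (hT : T = T.orthogonalBilin (dotProductBilin _ _))
    (htT : Submodule.span _ (Set.range t) ≤ T) (hiso : ∀ a b, form h.cube (z a) (z b) = 0) :
    ∃! C, HasType h T (Submodule.span _ (Set.range t)) (Submodule.span _ (Set.range e)) C ∧
      ∀ a, z a ∈ C := by
  have key := hasType_neighbour h hz ht he hT htT hiso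
  refine ⟨_, ⟨key, fun a => ?_⟩, fun C hC => ?_⟩
  · exact le_sup_left (a := Submodule.span R (Set.range z)) (Submodule.subset_span ⟨a, rfl⟩)
  · exact isSelfDual_of_le h.cube hC.1.1 key.1 (le_neighbour h hz hC.1 hC.2)

end Neighbours

/-- A functional prescribed on an independent family extends to the whole space and is a dot
product. This gives the surjectivity in both stages of the lift count. -/
theorem exists_dotProduct_eq {K : Type*} [Field K] {k n : ℕ} {v : Fin k → Fin n → K}
    (hv : LinearIndependent K v) (g : Fin k → K) : ∃ u, ∀ i, v i ⬝ᵥ u = g i := by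
  classical
  obtain ⟨f, hf⟩ := LinearMap.exists_extend ((Finsupp.linearCombination K g).comp hv.repr)
  refine ⟨fun i => f (Pi.single i 1), fun i => ?_⟩
  have h1 : f (v i) = g i := by
    have := LinearMap.congr_fun hf ⟨v i, Submodule.subset_span ⟨i, rfl⟩⟩
    simpa [hv.repr_eq_single i] using this
  rw [← h1, LinearMap.pi_apply_eq_sum_univ f (v i), dotProduct]
  refine Finset.sum_congr rfl fun j _ => ?_
  congr 2
  ext j'
  simp [Pi.single_apply, eq_comm]

/-! ### Possible values of the Gram obstruction. -/

section TorsionValues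

variable {R : Type*} [CommRing R] {γ : R}

/-- Families of scalars annihilated by `γ`. -/
def torsionValues (γ : R) (I : Type*) : AddSubgroup (I → R) :=
  AddSubgroup.pi Set.univ fun _ => (LinearMap.ker (LinearMap.mulLeft R γ)).toAddSubgroup

theorem mem_torsionValues {I : Type*} {f : I → R} :
    f ∈ torsionValues γ I ↔ ∀ s, γ * f s = 0 := by
  simp [torsionValues, AddSubgroup.mem_pi]

/-- Families of scalars annihilated by `γ` and vanishing on a set of indices. -/
def torsionValuesOff (γ : R) {I : Type*} (S : Set I) : AddSubgroup (I → R) :=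
  torsionValues γ I ⊓ AddSubgroup.pi S fun _ => ⊥

theorem mem_torsionValuesOff {I : Type*} {S : Set I} {f : I → R} :
    f ∈ torsionValuesOff γ S ↔ (∀ s, γ * f s = 0) ∧ ∀ s ∈ S, f s = 0 := by
  simp [torsionValuesOff, AddSubgroup.mem_pi, mem_torsionValues]

end TorsionValues

/-! ### The Gram matrix as a quadratic map. -/

section Gram

variable {R : Type*} [CommRing R] [IsLocalRing R] {γ : R} {N₁ N₂ : ℕ}
  (h : IsUniformizer γ) {ι : Type*}

/-- The Gram matrix of a family of words. -/
def gram (z : ι → Ambient R γ 2 N₁ N₂) : Sym2 ι → R :=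
  Sym2.lift ⟨fun a b => form h.cube (z a) (z b), fun _ _ => form_comm _ _ _⟩

/-- The derivative of the Gram matrix at `z`. -/
def gramDeriv (z : ι → Ambient R γ 2 N₁ N₂) : (ι → Ambient R γ 2 N₁ N₂) →+ (Sym2 ι → R) :=
  AddMonoidHom.mk' (fun w => Sym2.lift
    ⟨fun a b => form h.cube (z a) (w b) + form h.cube (z b) (w a), fun _ _ => add_comm _ _⟩)
    (fun v w => by
      ext s
      induction s with
      | h a b => simp only [Sym2.lift_mk, Pi.add_apply, map_add]; ring)

@[simp] theorem gram_mk (z : ι → Ambient R γ 2 N₁ N₂) (a b : ι) :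
    gram h z s(a, b) = form h.cube (z a) (z b) := rfl

@[simp] theorem gramDeriv_mk (z w : ι → Ambient R γ 2 N₁ N₂) (a b : ι) :
    gramDeriv h z w s(a, b) = form h.cube (z a) (w b) + form h.cube (z b) (w a) := rfl

theorem gram_add (z w : ι → Ambient R γ 2 N₁ N₂) :
    gram h (z + w) = gram h z + gramDeriv h z w + gram h w := by
  ext s
  induction s with
  | h a b =>
    simp only [gram_mk, gramDeriv_mk, Pi.add_apply, map_add, LinearMap.add_apply,
      form_comm h.cube (w a) (z b)]
    ring

theorem gram_eq_zero_iff (z : ι → Ambient R γ 2 N₁ N₂) :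
    gram h z = 0 ↔ ∀ a b, form h.cube (z a) (z b) = 0 := by
  constructor
  · intro hz a b
    exact congrFun hz s(a, b)
  · intro hz
    ext s
    induction s with
    | h a b => exact hz a b

-- The word γ(γu' | d'), with u' and d' lifting u and d, is torsion, and pairing with it lands in
-- the socle. Unlike a general multiple of γ it tests both residues of a word at the same order.
include h in
theorem exists_torsion_word (u : Fin N₁ → ResidueField R) (d : Fin N₂ → ResidueField R) :
    ∃ n : Ambient R γ 2 N₁ N₂, γ • n = 0 ∧ ∀ y : Ambient R γ 2 N₁ N₂, ∃ r,
      form h.cube y n = γ ^ 2 * r ∧ residue R r = res₁ y ⬝ᵥ u + res₂ h y ⬝ᵥ d := by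
  choose u' hu using fun i => residue_surjective (R := R) (u i)
  choose d' hd using fun i => residue_surjective (R := R) (d i)
  refine ⟨γ • word γ 2 (γ • u') d', ?_, fun y => ?_⟩
  · exact (gamma_smul_eq_zero_iff h _).2 ⟨_, (res₁_eq_zero_iff h _).2 ⟨_, _, rfl⟩, rfl⟩
  · obtain ⟨c, e, rfl⟩ := exists_word y
    refine ⟨c ⬝ᵥ u' + e ⬝ᵥ d', ?_, ?_⟩
    · rw [map_smul, form_word, dotProduct_smul, smul_eq_mul, smul_eq_mul]
      ring
    · rw [map_add, residue_dotProduct, residue_dotProduct, res₁_word, res₂_word, funext hu,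
        funext hd]

theorem card_torsionValues [Finite R] {I : Type*} [Fintype I] (h : IsUniformizer γ) :
    Nat.card (torsionValues γ I) = Nat.card (ResidueField R) ^ Fintype.card I := by
  have e : torsionValues γ I ≃ (I → LinearMap.ker (LinearMap.mulLeft R γ)) :=
    { toFun := fun f s => ⟨f.1 s, mem_torsionValues.1 f.2 s⟩
      invFun := fun f => ⟨fun s => f s, mem_torsionValues.2 fun s => (f s).2⟩
      left_inv := fun f => rfl
      right_inv := fun f => rfl }
  rw [Nat.card_congr e, Nat.card_fun, card_gamma_torsion h.max h.cube h.sq,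
    Nat.card_eq_fintype_card (α := I)]

theorem card_torsionValuesOff [Finite R] {I J : Type*} [Fintype I] [Fintype J]
    (h : IsUniformizer γ) (g : J → I) (hg : Function.Injective g) :
    Nat.card (torsionValuesOff γ (Set.range g)) =
      Nat.card (ResidueField R) ^ (Fintype.card I - Fintype.card J) := by
  classical
  have e : torsionValuesOff γ (Set.range g) ≃
      torsionValues γ {s // ¬ s ∈ Set.range g} :=
    { toFun := fun f => ⟨fun s => f.1 s, mem_torsionValues.2
        fun s => (mem_torsionValuesOff.1 f.2).1 s⟩
      invFun := fun f => ⟨fun s => if hs : s ∈ Set.range g then 0 else f.1 ⟨s, hs⟩,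
        mem_torsionValuesOff.2 ⟨fun s => by
          split_ifs with hs
          · exact mul_zero _
          · exact mem_torsionValues.1 f.2 ⟨s, hs⟩, fun s hs => dif_pos hs⟩⟩
      left_inv := fun f => by
        ext s
        change (if hs : s ∈ Set.range g then 0 else f.1 s) = f.1 s
        split_ifs with hs
        · exact ((mem_torsionValuesOff.1 f.2).2 s hs).symm
        · rfl
      right_inv := fun f => by
        ext s
        exact dif_neg s.2 }
  rw [Nat.card_congr e, card_torsionValues h, Fintype.card_subtype_compl]
  congr 2
  exact (Fintype.card_congr (Equiv.ofInjective g hg)).symm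

end Gram

/-! ### Counting isotropic lifts in two stages. -/

section LiftCount

variable {R : Type*} [CommRing R] [IsLocalRing R] [Finite R] {γ : R} {N₁ N₂ : ℕ}
  (h : IsUniformizer γ) {k l : ℕ} {t : Fin k → Fin N₁ → ResidueField R}
  {e : Fin l → Fin N₂ → ResidueField R}
include h

/-- Lifts are moved by multiples of γ. Isotropy of `t` makes γ times the Gram matrix torsion, and
isotropy of `e` already kills its block on `Fin l`; that block imposes no condition, hence the
difference in the exponent. -/
theorem card_lift_gamma_mul_gram_eq_zero (h2 : (2 : ResidueField R) ≠ 0)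
    (ht : LinearIndependent (ResidueField R) t) (htiso : ∀ i j, t i ⬝ᵥ t j = 0)
    (heiso : ∀ i j, e i ⬝ᵥ e j = 0) :
    Nat.card {z : Fin k ⊕ Fin l → Ambient R γ 2 N₁ N₂ // IsLift h t e z ∧ γ • gram h z = 0} *
      Nat.card (ResidueField R) ^
        (Fintype.card (Sym2 (Fin k ⊕ Fin l)) - Fintype.card (Sym2 (Fin l))) =
      Nat.card {z : Fin k ⊕ Fin l → Ambient R γ 2 N₁ N₂ // IsLift h t e z} := by
  rw [← card_torsionValuesOff h (Sym2.map (Sum.inr : Fin l → Fin k ⊕ Fin l))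
    (Sym2.map.injective Sum.inr_injective)]
  have hres (y m : Ambient R γ 2 N₁ N₂) : γ * form h.cube y (γ • m) = γ ^ 2 * form h.cube y m := by
    rw [map_smul, smul_eq_mul]; ring
  have hker (y m : Ambient R γ 2 N₁ N₂) : γ * (γ * form h.cube y (γ • m)) = 0 := by
    rw [hres]
    linear_combination form h.cube y m * h.cube
  have hoff {f : Sym2 (Fin k ⊕ Fin l) → R} :
      (∀ s ∈ Set.range (Sym2.map (Sum.inr : Fin l → Fin k ⊕ Fin l)), f s = 0) ↔
        ∀ i j, f s(Sum.inr i, Sum.inr j) = 0 := by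
    constructor
    · exact fun hs i j => hs _ ⟨s(i, j), rfl⟩
    · rintro hs _ ⟨s, rfl⟩
      induction s with
      | h i j => exact hs i j
  apply card_zero_mul_card_eq
    (Y := {z : Fin k ⊕ Fin l → Ambient R γ 2 N₁ N₂ | IsLift h t e z})
    (G := AddSubgroup.pi Set.univ fun _ => ((⊤ : Code R γ 2 N₁ N₂).map
      (LinearMap.lsmul R (Ambient R γ 2 N₁ N₂) γ)).toAddSubgroup)
  · intro z hz w hw
    have hw (a) : res₁ (w a) = 0 ∧ res₂ h (w a) = 0 := by
      obtain ⟨x, -, hx⟩ := hw a trivial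
      exact (res_eq_zero_iff h _).2 ⟨x, hx.symm⟩
    refine ⟨fun i => ?_, fun j => ⟨?_, ?_⟩⟩
    · rw [Pi.add_apply, map_add, hz.1, (hw _).1, add_zero]
    · rw [Pi.add_apply, map_add, (hz.2 j).1, (hw _).1, add_zero]
    · rw [Pi.add_apply, map_add, (hz.2 j).2, (hw _).2, add_zero]
  · intro z hz
    have hrr (i j) : γ * form h.cube (z (Sum.inr i)) (z (Sum.inr j)) = 0 := by
      obtain ⟨r, hr, hr'⟩ := exists_form_eq_of_res₁_eq_zero h _ (z (Sum.inr j)) (hz.2 i).1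
      rw [hr, ← mul_assoc, ← pow_two, gamma_sq_mul_eq_zero_iff h.max h.cube h.sq,
        hr' (hz.2 j).1, (hz.2 i).2, (hz.2 j).2, heiso]
    rw [mem_torsionValuesOff, hoff]
    refine ⟨fun s => ?_, hrr⟩
    induction s with
    | h a b =>
      change γ * (γ * form h.cube (z a) (z b)) = 0
      rw [← mul_assoc, ← pow_two, gamma_sq_mul_eq_zero_iff h.max h.cube h.sq, residue_form h]
      rcases a with i | i
      · rcases b with j | j
        · rw [hz.1, hz.1, htiso]
        · rw [(hz.2 j).1, dotProduct_zero]
      · rw [(hz.2 i).1, zero_dotProduct]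
  · intro z hz
    refine ⟨(AddMonoidHom.mulLeft (fun _ => γ)).comp (gramDeriv h z), ?_, ?_⟩
    · apply le_antisymm
      · rintro _ ⟨w, hw, rfl⟩
        choose x hx using fun a => hw a trivial
        have hx (a) : w a = γ • x a := (hx a).2.symm
        rw [mem_torsionValuesOff, hoff]
        constructor
        · intro s
          induction s with
          | h a b =>
            change γ * (γ * (form h.cube (z a) (w b) + form h.cube (z b) (w a))) = 0
            rw [mul_add, mul_add, hx, hx, hker, hker, add_zero]
        · intro i j
          change γ * (form h.cube (z _) (w _) + form h.cube (z _) (w _)) = 0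
          rw [mul_add, hx, hx, hres, hres, ← mul_add,
            gamma_sq_mul_eq_zero_iff h.max h.cube h.sq, map_add, residue_form h, residue_form h,
            (hz.2 i).1, (hz.2 j).1, zero_dotProduct, zero_dotProduct, add_zero]
      · intro f hf
        rw [mem_torsionValuesOff, hoff] at hf
        obtain ⟨hf1, hf2⟩ := hf
        choose r hr using fun s => (gamma_mul_eq_zero_iff h.max h.cube h.sq (f s)).1 (hf1 s)
        -- Only `res₁` of `z` enters here. A pair within `t` receives two equal contributions, hence
        -- the half; a mixed pair receives only the one from the word over `e`, as `res₁` vanishes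
        -- there.
        choose u hu using fun b => exists_dotProduct_eq ht
          (Sum.elim (fun j i => residue R (r s(Sum.inl i, Sum.inl j)) / 2)
            (fun j i => residue R (r s(Sum.inl i, Sum.inr j))) b)
        choose x hx using fun b => exists_res_eq h (u b) (0 : Fin N₂ → ResidueField R)
        refine ⟨fun b => γ • x b, fun b _ => ⟨x b, trivial, rfl⟩, ?_⟩
        ext s
        induction s with
        | h a b =>
          change γ * (form h.cube (z a) (γ • x b) + form h.cube (z b) (γ • x a)) = f s(a, b)
          rw [mul_add, hres, hres]
          by_cases hab : ∃ i j, a = Sum.inr i ∧ b = Sum.inr j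
          · obtain ⟨i, j, rfl, rfl⟩ := hab
            rw [hf2, ← mul_add, gamma_sq_mul_eq_zero_iff h.max h.cube h.sq, map_add,
              residue_form h, residue_form h, (hz.2 i).1, (hz.2 j).1, zero_dotProduct,
              zero_dotProduct, add_zero]
          rw [hr, ← mul_add, ← sub_eq_zero, ← mul_sub,
            gamma_sq_mul_eq_zero_iff h.max h.cube h.sq, map_sub, map_add, residue_form h,
            residue_form h, (hx _).1, (hx _).1]
          rcases a with i | i <;> rcases b with j | j
          · rw [hz.1, hz.1, hu, hu]
            simp only [Sum.elim_inl]
            rw [Sym2.eq_swap (a := Sum.inl j)]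
            field_simp
            ring
          · rw [hz.1, (hz.2 j).1, hu]
            simp
          · rw [hz.1, (hz.2 i).1, hu, Sym2.eq_swap]
            simp
          · exact absurd ⟨i, j, rfl, rfl⟩ hab
    · intro w hw
      choose x hx using fun a => hw a trivial
      have hx (a) : w a = γ • x a := (hx a).2.symm
      -- The quadratic term carries γ³.
      have h0 : γ • gram h w = 0 := by
        ext s
        induction s with
        | h a b =>
          change γ * form h.cube (w a) (w b) = 0
          rw [hx, hx, hres, map_smul, LinearMap.smul_apply, smul_eq_mul]
          linear_combination form h.cube (x a) (x b) * h.cube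
      rw [gram_add, smul_add, smul_add, h0, add_zero]
      rfl

/-- Now lifts are moved by γ-torsion words. These see the second-block residues as well, so the
block on `Fin l` can be corrected too and every torsion value is attained. -/
theorem card_lift_gram_eq_zero (h2 : (2 : ResidueField R) ≠ 0)
    (ht : LinearIndependent (ResidueField R) t) (he : LinearIndependent (ResidueField R) e) :
    Nat.card {z : Fin k ⊕ Fin l → Ambient R γ 2 N₁ N₂ // IsLift h t e z ∧ gram h z = 0} *
      Nat.card (ResidueField R) ^ (Fintype.card (Sym2 (Fin k ⊕ Fin l))) =
    Nat.card {z : Fin k ⊕ Fin l → Ambient R γ 2 N₁ N₂ // IsLift h t e z ∧ γ • gram h z = 0} := by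
  rw [← card_torsionValues h]
  have hmul (y m : Ambient R γ 2 N₁ N₂) (hm : γ • m = 0) : γ * form h.cube y m = 0 := by
    rw [← smul_eq_mul, ← map_smul, hm, map_zero]
  have heq : Nat.card {z : Fin k ⊕ Fin l → Ambient R γ 2 N₁ N₂ //
      IsLift h t e z ∧ gram h z = 0} =
      Nat.card {z : Fin k ⊕ Fin l → Ambient R γ 2 N₁ N₂ //
        z ∈ {z | IsLift h t e z ∧ γ • gram h z = 0} ∧ gram h z = 0} := by
    refine Nat.card_congr (Equiv.subtypeEquivRight fun z => ?_)
    constructor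
    · rintro ⟨h1, h2⟩
      exact ⟨⟨h1, by rw [h2, smul_zero]⟩, h2⟩
    · rintro ⟨⟨h1, -⟩, h2⟩
      exact ⟨h1, h2⟩
  rw [heq]
  apply card_zero_mul_card_eq
    (Y := {z : Fin k ⊕ Fin l → Ambient R γ 2 N₁ N₂ | IsLift h t e z ∧ γ • gram h z = 0})
    (G := AddSubgroup.pi Set.univ fun _ =>
      (LinearMap.ker (LinearMap.lsmul R (Ambient R γ 2 N₁ N₂) γ)).toAddSubgroup)
  · rintro z ⟨hz, hg⟩ w hw
    have hw0 (a) : γ • w a = 0 := hw a trivial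
    have hw (a) : res₁ (w a) = 0 ∧ res₂ h (w a) = 0 := by
      obtain ⟨x, -, hx⟩ := (gamma_smul_eq_zero_iff h _).1 (hw0 a)
      exact (res_eq_zero_iff h _).2 ⟨x, hx⟩
    refine ⟨⟨fun i => ?_, fun j => ⟨?_, ?_⟩⟩, ?_⟩
    · rw [Pi.add_apply, map_add, hz.1, (hw _).1, add_zero]
    · rw [Pi.add_apply, map_add, (hz.2 j).1, (hw _).1, add_zero]
    · rw [Pi.add_apply, map_add, (hz.2 j).2, (hw _).2, add_zero]
    · rw [gram_add, smul_add, smul_add, hg, zero_add]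
      ext s
      induction s with
      | h a b =>
        change γ * (form h.cube (z a) (w b) + form h.cube (z b) (w a)) +
          γ * form h.cube (w a) (w b) = 0
        rw [mul_add, hmul _ _ (hw0 _), hmul _ _ (hw0 _), hmul _ _ (hw0 _)]
        simp
  · rintro z ⟨-, hg⟩
    exact mem_torsionValues.2 fun s => congrFun hg s
  · rintro z ⟨hz, -⟩
    refine ⟨gramDeriv h z, ?_, ?_⟩
    · apply le_antisymm
      · rintro _ ⟨w, hw, rfl⟩
        have hw0 (a) : γ • w a = 0 := hw a trivial
        refine mem_torsionValues.2 fun s => ?_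
        induction s with
        | h a b =>
          rw [gramDeriv_mk, mul_add, hmul _ _ (hw0 _), hmul _ _ (hw0 _), add_zero]
      · intro f hf
        choose r hr using fun s =>
          (gamma_mul_eq_zero_iff h.max h.cube h.sq (f s)).1 (mem_torsionValues.1 hf s)
        -- The second blocks `d` settle the pairs within `e`. They disturb the mixed pairs by `res₂`
        -- of the words over `t`, and `u` compensates for that.
        choose d hd using fun j => exists_dotProduct_eq he
          (fun i => residue R (r s(Sum.inr i, Sum.inr j)) / 2)
        choose u hu using fun b => exists_dotProduct_eq ht
          (Sum.elim (fun j i => residue R (r s(Sum.inl i, Sum.inl j)) / 2)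
            (fun j i => residue R (r s(Sum.inl i, Sum.inr j)) -
              res₂ h (z (Sum.inl i)) ⬝ᵥ d j) b)
        choose w hw hform using fun b => exists_torsion_word h (u b)
          (Sum.elim (fun _ => (0 : Fin N₂ → ResidueField R)) d b)
        choose r' hr' hres using hform
        refine ⟨w, fun b _ => hw b, ?_⟩
        ext s
        induction s with
        | h a b =>
          rw [gramDeriv_mk, hr', hr', hr, ← mul_add, ← sub_eq_zero, ← mul_sub,
            gamma_sq_mul_eq_zero_iff h.max h.cube h.sq, map_sub, map_add, hres, hres]
          rcases a with i | i <;> rcases b with j | j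
          · rw [hz.1, hz.1, hu, hu]
            simp only [Sum.elim_inl, dotProduct_zero]
            rw [Sym2.eq_swap (a := Sum.inl j)]
            field_simp
            ring
          · rw [hz.1, (hz.2 j).1, hu]
            simp
          · rw [hz.1, (hz.2 i).1, hu, Sym2.eq_swap]
            simp
          · rw [(hz.2 i).1, (hz.2 i).2, (hz.2 j).1, (hz.2 j).2]
            simp only [Sum.elim_inr, zero_dotProduct, zero_add]
            rw [hd, hd, Sym2.eq_swap (a := Sum.inr j)]
            field_simp
            ring
    · intro w hw
      have hw0 (a) : γ • w a = 0 := hw a trivial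
      have h0 : gram h w = 0 := by
        rw [gram_eq_zero_iff]
        intro a b
        obtain ⟨x, hx, hx'⟩ := (gamma_smul_eq_zero_iff h _).1 (hw0 b)
        rw [hx', map_smul, ← LinearMap.smul_apply, ← map_smul, hw0, map_zero,
          LinearMap.zero_apply]
      rw [gram_add, h0, add_zero]

end LiftCount

/-! ### Exponent arithmetic. -/

theorem two_mul_card_sym2 (α : Type*) [Fintype α] :
    2 * Fintype.card (Sym2 α) = (Fintype.card α + 1) * Fintype.card α := by
  classical
  rw [Sym2.card, Nat.choose_two_right, Nat.add_sub_cancel, Nat.mul_div_cancel']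
  rw [mul_comm]
  exact (Nat.even_mul_succ_self _).two_dvd

theorem two_mul_mul_div_two_add (l p : ℕ) : 2 * (l * (2 * p + l - 1) / 2) + l = l * (2 * p + l) := by
  rcases l with _ | l
  · simp
  · have h : 2 ∣ (l + 1) * (2 * p + (l + 1) - 1) := by
      rw [show (l + 1) * (2 * p + (l + 1) - 1) = 2 * (p * (l + 1)) + l * (l + 1) by
        rw [← add_assoc, Nat.add_sub_cancel]; ring]
      exact dvd_add (dvd_mul_right _ _) (Nat.even_mul_succ_self l).two_dvd
    rw [Nat.mul_div_cancel' h, ← add_assoc (2 * p), Nat.add_sub_cancel]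
    ring

/-- The summands are the logarithms to base q of the codes per type, the lifts inside one code and
the conditions of the two Gram stages; the right side is that of all lifts. The truncated
subtractions of 1 can only bite when multiplied by k = 0 or l = 0, and the halving is exact. -/
theorem exponent_identity {k l n N : ℕ} (hk : k ≤ n) (hl : 2 * l ≤ N) :
    (k * (n + N - 1) + l * (2 * n - 2 * k + l - 1) / 2) +
      (k * (3 * n + N - k) + l * (3 * n + N - k - l)) +
      (Fintype.card (Sym2 (Fin k ⊕ Fin l)) +
        (Fintype.card (Sym2 (Fin k ⊕ Fin l)) - Fintype.card (Sym2 (Fin l)))) =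
      k * (4 * n + 2 * N) + l * (4 * n + N) := by
  have h1 := two_mul_card_sym2 (Fin k ⊕ Fin l)
  have h2 := two_mul_card_sym2 (Fin l)
  rw [Fintype.card_sum, Fintype.card_fin, Fintype.card_fin] at h1
  rw [Fintype.card_fin] at h2
  have h3 : Fintype.card (Sym2 (Fin l)) ≤ Fintype.card (Sym2 (Fin k ⊕ Fin l)) :=
    Fintype.card_le_of_injective _ (Sym2.map.injective Sum.inr_injective)
  generalize Fintype.card (Sym2 (Fin k ⊕ Fin l)) = S at *
  generalize Fintype.card (Sym2 (Fin l)) = S' at *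
  obtain ⟨S, rfl⟩ := Nat.exists_eq_add_of_le h3
  obtain ⟨p, rfl⟩ := Nat.exists_eq_add_of_le hk
  obtain ⟨r, rfl⟩ := Nat.exists_eq_add_of_le hl
  have h4 := two_mul_mul_div_two_add l p
  have h5 : k * (k + p + (2 * l + r) - 1) + k = k * (k + p + (2 * l + r)) := by
    rcases k with _ | k
    · simp
    · rw [show k + 1 + p + (2 * l + r) - 1 = k + p + (2 * l + r) by omega]
      ring
  rw [show 2 * (k + p) - 2 * k = 2 * p by omega, Nat.add_sub_cancel_left,
    show 3 * (k + p) + (2 * l + r) - k = 2 * k + 3 * p + 2 * l + r by omega,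
    show 2 * k + 3 * p + 2 * l + r - l = 2 * k + 3 * p + l + r by omega]
  generalize l * (2 * p + l - 1) / 2 = W at *
  generalize k * (k + p + (2 * l + r) - 1) = V at *
  zify at *
  linarith

/-! ### The number of self-dual codes over one triple (T, T₀, Q). -/

section Fibres

variable {R : Type*} [CommRing R] [IsLocalRing R] [Finite R] {γ : R} {N₁ N₂ : ℕ}
  (h : IsUniformizer γ) {k l : ℕ} {t : Fin k → Fin N₁ → ResidueField R}
  {e : Fin l → Fin N₂ → ResidueField R}
include h

omit [Finite R] in
theorem card_lift_mem (C : Code R γ 2 N₁ N₂) (ht : ∀ i, t i ∈ resCode C)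
    (he : ∀ j, e j ∈ resCode₂ h C) :
    Nat.card {z : Fin k ⊕ Fin l → Ambient R γ 2 N₁ N₂ // IsLift h t e z ∧ ∀ a, z a ∈ C} =
      Nat.card (C ⊓ LinearMap.ker res₁ : Submodule R _) ^ k *
        Nat.card (C ⊓ LinearMap.ker res₁ ⊓ LinearMap.ker (res₂ h) : Submodule R _) ^ l := by
  let f : {z : Fin k ⊕ Fin l → Ambient R γ 2 N₁ N₂ // IsLift h t e z ∧ ∀ a, z a ∈ C} ≃
      (∀ i, {x // x ∈ C ∧ res₁ x = t i}) ×
        ∀ j, {x // x ∈ C ⊓ LinearMap.ker res₁ ∧ res₂ h x = e j} :=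
    { toFun := fun z => (fun i => ⟨z.1 (Sum.inl i), z.2.2 _, z.2.1.1 i⟩,
        fun j => ⟨z.1 (Sum.inr j), ⟨z.2.2 _, (z.2.1.2 j).1⟩, (z.2.1.2 j).2⟩)
      invFun := fun p => ⟨Sum.elim (fun i => (p.1 i).1) (fun j => (p.2 j).1),
        ⟨fun i => (p.1 i).2.2, fun j => ⟨(p.2 j).2.1.2, (p.2 j).2.2⟩⟩, by
          rintro (i | j)
          · exact (p.1 i).2.1
          · exact (p.2 j).2.1.1⟩
      left_inv := fun z => by
        ext1
        exact Sum.elim_comp_inl_inr z.1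
      right_inv := fun p => rfl }
  rw [Nat.card_congr f, Nat.card_prod, Nat.card_pi, Nat.card_pi]
  congr 1
  · rw [Finset.prod_congr rfl fun i _ => card_fiber res₁ C (ht i)]
    simp
  · rw [Finset.prod_congr rfl fun j _ => card_fiber (res₂ h) (C ⊓ LinearMap.ker res₁) (he j)]
    simp

/-- Double counting of pairs (code, lift inside it): self-duality makes the lift isotropic, and an
isotropic lift determines the code. -/
theorem card_isotropic_lifts {T : Submodule (ResidueField R) (Fin N₁ → ResidueField R)}
    (ht : LinearIndependent (ResidueField R) t) (he : LinearIndependent (ResidueField R) e)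
    (hT : T = T.orthogonalBilin (dotProductBilin _ _))
    (htT : Submodule.span _ (Set.range t) ≤ T) (c : ℕ)
    (hc : ∀ C : Code R γ 2 N₁ N₂, HasType h T (Submodule.span _ (Set.range t))
      (Submodule.span _ (Set.range e)) C →
      Nat.card {z : Fin k ⊕ Fin l → Ambient R γ 2 N₁ N₂ // IsLift h t e z ∧ ∀ a, z a ∈ C} = c) :
    Nat.card {z : Fin k ⊕ Fin l → Ambient R γ 2 N₁ N₂ // IsLift h t e z ∧ gram h z = 0} =
      Nat.card {C : Code R γ 2 N₁ N₂ // HasType h T (Submodule.span _ (Set.range t))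
        (Submodule.span _ (Set.range e)) C} * c := by
  classical
  have : Finite (Code R γ 2 N₁ N₂) := Finite.of_injective _ SetLike.coe_injective
  have := Fintype.ofFinite {C : Code R γ 2 N₁ N₂ // HasType h T (Submodule.span _ (Set.range t))
        (Submodule.span _ (Set.range e)) C}
  let f : (Σ C : {C : Code R γ 2 N₁ N₂ // HasType h T (Submodule.span _ (Set.range t))
        (Submodule.span _ (Set.range e)) C},
        {z : Fin k ⊕ Fin l → Ambient R γ 2 N₁ N₂ // IsLift h t e z ∧ ∀ a, z a ∈ C.1}) →
      {z : Fin k ⊕ Fin l → Ambient R γ 2 N₁ N₂ // IsLift h t e z ∧ gram h z = 0} :=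
    fun p => ⟨p.2.1, p.2.2.1, (gram_eq_zero_iff h _).2 fun a b => by
      have hb := p.2.2.2 b
      have ha := p.2.2.2 a
      have hsd : p.1.1 = euclideanDual h.cube p.1.1 := p.1.2.1
      exact hsd.le ha _ hb⟩
  have hf : Function.Bijective f := by
    constructor
    · rintro ⟨⟨C, hC⟩, ⟨z, hz, hzC⟩⟩ ⟨⟨C', hC'⟩, ⟨z', hz', hzC'⟩⟩ hff
      obtain rfl : z = z' := congrArg Subtype.val hff
      have hiso := (gram_eq_zero_iff h z).1 (f ⟨⟨C, hC⟩, ⟨z, hz, hzC⟩⟩).2.2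
      obtain rfl := (existsUnique_neighbour h hz ht he hT htT hiso).unique ⟨hC, hzC⟩ ⟨hC', hzC'⟩
      rfl
    · rintro ⟨z, hz, hg⟩
      obtain ⟨C, ⟨hC, hzC⟩, -⟩ := existsUnique_neighbour h hz ht he hT htT
        ((gram_eq_zero_iff h z).1 hg)
      exact ⟨⟨⟨C, hC⟩, ⟨z, hz, hzC⟩⟩, rfl⟩
  rw [← Nat.card_congr (Equiv.ofBijective f hf), Nat.card_sigma,
    Finset.sum_congr rfl fun C _ => hc C.1 C.2]
  simp [Nat.card_eq_fintype_card]

theorem card_eq_of_isSelfDual {n : ℕ} {C : Code R γ 2 (2 * n) N₂} (hC : IsSelfDual h.cube C) :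
    Nat.card C = Nat.card (ResidueField R) ^ (3 * n + N₂) := by
  have h1 := card_mul_card_euclideanDual h C
  rw [← hC, card_ambient h, ← pow_two,
    show 3 * (2 * n) + 2 * N₂ = (3 * n + N₂) * 2 by ring, pow_mul] at h1
  exact Nat.pow_left_injective two_ne_zero h1

omit h [Finite R] in
theorem card_span_eq_pow {n s : ℕ} {v : Fin s → Fin n → ResidueField R}
    (hv : LinearIndependent (ResidueField R) v) :
    Nat.card (Submodule.span (ResidueField R) (Set.range v)) =
      Nat.card (ResidueField R) ^ s := by
  rw [Module.natCard_eq_pow_finrank (K := ResidueField R), finrank_span_eq_card hv,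
    Fintype.card_fin]

omit h [Finite R] in
theorem exists_basis_family {n s : ℕ}
    {W : Submodule (ResidueField R) (Fin n → ResidueField R)}
    (hW : finrank (ResidueField R) W = s) :
    ∃ v : Fin s → Fin n → ResidueField R, LinearIndependent (ResidueField R) v ∧
      Submodule.span (ResidueField R) (Set.range v) = W := by
  let b := Module.finBasisOfFinrankEq (ResidueField R) W hW
  refine ⟨fun i => b i, b.linearIndependent.map' W.subtype W.ker_subtype, ?_⟩
  have := congrArg (Submodule.map W.subtype) b.span_eq
  rw [Submodule.map_span, ← Set.range_comp, Submodule.map_top, Submodule.range_subtype] at this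
  exact this

/-- The number of self-dual codes with prescribed residue and torsion codes. -/
theorem card_hasType (h2 : (2 : ResidueField R) ≠ 0) {n : ℕ}
    {T T₀ : Submodule (ResidueField R) (Fin (2 * n) → ResidueField R)}
    {Q : Submodule (ResidueField R) (Fin N₂ → ResidueField R)}
    (hT : T = T.orthogonalBilin (dotProductBilin _ _)) (hT₀ : T₀ ≤ T)
    (hQ : Q ≤ Q.orthogonalBilin (dotProductBilin _ _))
    (hk : finrank (ResidueField R) T₀ = k) (hl : finrank (ResidueField R) Q = l) :
    Nat.card {C : Code R γ 2 (2 * n) N₂ // HasType h T T₀ Q C} =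
      Nat.card (ResidueField R) ^
        (k * (n + N₂ - 1) + l * (2 * n - 2 * k + l - 1) / 2) := by
  have := Fintype.ofFinite (ResidueField R)
  have hq : 0 < Nat.card (ResidueField R) := Nat.card_pos
  have hiso₀ : T₀ ≤ T₀.orthogonalBilin (dotProductBilin _ _) := by
    refine hT₀.trans ?_
    conv_lhs => rw [hT]
    exact Submodule.orthogonalBilin_le hT₀
  have hkn : k ≤ n := by have := two_mul_finrank_le hiso₀; omega
  have hlN : 2 * l ≤ N₂ := by have := two_mul_finrank_le hQ; omega
  obtain ⟨t, ht, rfl⟩ := exists_basis_family hk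
  obtain ⟨e, he, rfl⟩ := exists_basis_family hl
  have hdiv {a b x : ℕ} (hab : Nat.card (ResidueField R) ^ a * x = Nat.card (ResidueField R) ^ b)
      (hle : a ≤ b) : x = Nat.card (ResidueField R) ^ (b - a) := by
    apply Nat.eq_of_mul_eq_mul_left (pow_pos hq a)
    rw [hab, ← pow_add, Nat.add_sub_cancel' hle]
  -- Dividing |C| by |T₀| and then by |Q| gives the sizes of the fibres over the vectors of `t` and
  -- of `e`; they depend only on k and l.
  have hcard (C : Code R γ 2 (2 * n) N₂) (hC : HasType h T
      (Submodule.span _ (Set.range t)) (Submodule.span _ (Set.range e)) C) :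
      Nat.card {z : Fin k ⊕ Fin l → Ambient R γ 2 (2 * n) N₂ //
        IsLift h t e z ∧ ∀ a, z a ∈ C} = Nat.card (ResidueField R) ^
          (k * (3 * n + N₂ - k) + l * (3 * n + N₂ - k - l)) := by
    obtain ⟨hsd, -, h0, hq⟩ := hC
    have e1 := card_map_mul_card_inf_ker res₁ C
    rw [show C.map res₁ = _ from h0, card_span_eq_pow ht, card_eq_of_isSelfDual h hsd] at e1
    have e1 := hdiv e1 (by omega)
    have e2 := card_map_mul_card_inf_ker (res₂ h) (C ⊓ LinearMap.ker res₁)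
    rw [show (C ⊓ LinearMap.ker res₁).map (res₂ h) = _ from hq, card_span_eq_pow he, e1] at e2
    have e2 := hdiv e2 (by omega)
    rw [card_lift_mem h C (fun i => h0 ▸ Submodule.subset_span ⟨i, rfl⟩)
      (fun j => hq ▸ Submodule.subset_span ⟨j, rfl⟩), e1, e2, pow_add, mul_comm k, mul_comm l,
      pow_mul, pow_mul]
  have htop : Nat.card {z : Fin k ⊕ Fin l → Ambient R γ 2 (2 * n) N₂ // IsLift h t e z} =
      Nat.card (ResidueField R) ^ (k * (4 * n + 2 * N₂) + l * (4 * n + N₂)) := by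
    have h0 : resCode (⊤ : Code R γ 2 (2 * n) N₂) = ⊤ := by
      rw [eq_top_iff]
      rintro a -
      obtain ⟨x, hx, -⟩ := exists_res_eq h a (0 : Fin N₂ → ResidueField R)
      exact ⟨x, trivial, hx⟩
    have h1 : resCode₂ h (⊤ : Code R γ 2 (2 * n) N₂) = ⊤ := by
      rw [eq_top_iff]
      rintro b -
      obtain ⟨x, hx, hx'⟩ := exists_res_eq h (0 : Fin (2 * n) → ResidueField R) b
      exact ⟨x, ⟨trivial, hx⟩, hx'⟩
    have e1 := card_map_mul_card_inf_ker res₁ (⊤ : Code R γ 2 (2 * n) N₂)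
    rw [show (⊤ : Code R γ 2 (2 * n) N₂).map res₁ = _ from h0, card_top_submodule,
      card_top_submodule, card_ambient h, Nat.card_fun, Nat.card_fin] at e1
    have e1 := hdiv e1 (by omega)
    have e2 := card_map_mul_card_inf_ker (res₂ h) (⊤ ⊓ LinearMap.ker
      (res₁ : Ambient R γ 2 (2 * n) N₂ →ₛₗ[residue R] _))
    rw [show (⊤ ⊓ LinearMap.ker
      (res₁ : Ambient R γ 2 (2 * n) N₂ →ₛₗ[residue R] _)).map (res₂ h) = _ from h1,
      card_top_submodule, e1, Nat.card_fun, Nat.card_fin] at e2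
    have e2 := hdiv e2 (by omega)
    have := card_lift_mem h (⊤ : Code R γ 2 (2 * n) N₂) (t := t) (e := e)
      (fun i => h0 ▸ trivial) (fun j => h1 ▸ trivial)
    rw [e1, e2, ← pow_mul, ← pow_mul, ← pow_add] at this
    simp only [Submodule.mem_top, implies_true, and_true] at this
    rw [this]
    congr 1
    rw [show 3 * (2 * n) + 2 * N₂ - 2 * n = 4 * n + 2 * N₂ by omega,
      show 4 * n + 2 * N₂ - N₂ = 4 * n + N₂ by omega]
    ring
  have key := card_lift_gamma_mul_gram_eq_zero h h2 ht
    ((span_isotropic_iff t).1 hiso₀) ((span_isotropic_iff e).1 hQ)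
  rw [← card_lift_gram_eq_zero h h2 ht he, card_isotropic_lifts h ht he hT hT₀ _ hcard, htop,
    ← exponent_identity hkn hlN] at key
  generalize Fintype.card (Sym2 (Fin k ⊕ Fin l)) = S at key
  generalize S - Fintype.card (Sym2 (Fin l)) = S' at key
  generalize k * (3 * n + N₂ - k) + l * (3 * n + N₂ - k - l) = c at key
  apply Nat.eq_of_mul_eq_mul_right (pow_pos hq (c + (S + S')))
  rw [← pow_add, ← add_assoc _ c, ← key, pow_add _ c, pow_add _ S, mul_assoc, mul_assoc]

end Fibres

theorem sum_comp_eq_sum_card_mul {α : Type*} [Fintype α] (d : α → ℕ) (m : ℕ) (hd : ∀ a, d a < m)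
    (g : ℕ → ℚ) :
    ∑ a, g (d a) = ∑ k ∈ Finset.range m, (Nat.card {a // d a = k} : ℚ) * g k := by
  classical
  rw [← Finset.sum_fiberwise_of_maps_to (t := Finset.range m) (g := d)
    (fun a _ => Finset.mem_range.2 (hd a))]
  refine Finset.sum_congr rfl fun k _ => ?_
  rw [Finset.sum_congr rfl (g := fun _ => g k) fun a ha => by rw [(Finset.mem_filter.1 ha).2],
    Finset.sum_const, nsmul_eq_mul, Nat.card_eq_fintype_card, Fintype.card_subtype]

/-! ### Sums over self-dual and self-orthogonal codes of the residue field. -/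

section SelfOrthogonal

variable {F : Type*} [Field F] [Fintype F] {n : ℕ}

theorem two_mul_finrank_of_eq_orthogonal {T : Submodule F (Fin n → F)}
    (hT : T = T.orthogonalBilin (dotProductBilin F F)) : 2 * finrank F T = n := by
  have h1 := card_mul_card_dotProduct_orthogonal T
  rw [← hT, Module.natCard_eq_pow_finrank (K := F) (V := T), Nat.card_eq_fintype_card,
    ← pow_add, ← two_mul] at h1
  exact Nat.pow_right_injective (Fintype.one_lt_card (α := F)) h1

theorem eq_orthogonal_iff (T : Submodule F (Fin (2 * n) → F)) :
    T = T.orthogonalBilin (dotProductBilin F F) ↔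
      finrank F T = n ∧ T ≤ T.orthogonalBilin (dotProductBilin F F) := by
  constructor
  · intro hT
    have := two_mul_finrank_of_eq_orthogonal hT
    exact ⟨by omega, hT.le⟩
  · rintro ⟨hn, hT⟩
    have h1 := card_mul_card_dotProduct_orthogonal T
    rw [Module.natCard_eq_pow_finrank (K := F) (V := T), hn, Nat.card_eq_fintype_card (α := F)] at h1
    have h2 := Nat.eq_of_mul_eq_mul_left (pow_pos Fintype.card_pos n) (h1.trans
      (show Fintype.card F ^ (2 * n) = Fintype.card F ^ n * Fintype.card F ^ n by
        rw [two_mul, pow_add]))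
    apply SetLike.coe_injective
    apply Set.eq_of_subset_of_ncard_le hT _ (Set.toFinite _)
    change Nat.card (T.orthogonalBilin (dotProductBilin F F)) ≤ Nat.card T
    rw [h2, Module.natCard_eq_pow_finrank (K := F) (V := T), hn, Nat.card_eq_fintype_card]

theorem card_eq_orthogonal (h2 : (2 : F) ≠ 0) (n : ℕ) :
    (Nat.card {T : Submodule F (Fin (2 * n) → F) //
      T = T.orthogonalBilin (dotProductBilin F F)} : ℚ) = sigma F (2 * n) n := by
  rw [← card_isotropic_subspaces h2]
  exact_mod_cast Nat.card_congr (Equiv.subtypeEquivRight eq_orthogonal_iff)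

theorem sum_isotropic (h2 : (2 : F) ≠ 0)
    [Fintype {Q : Submodule F (Fin n → F) // Q ≤ Q.orthogonalBilin (dotProductBilin F F)}]
    (g : ℕ → ℚ) :
    ∑ Q : {Q : Submodule F (Fin n → F) // Q ≤ Q.orthogonalBilin (dotProductBilin F F)},
      g (finrank F Q.1) = ∑ l ∈ Finset.range (n / 2 + 1), sigma F n l * g l := by
  rw [sum_comp_eq_sum_card_mul (fun Q : {Q : Submodule F (Fin n → F) //
    Q ≤ Q.orthogonalBilin (dotProductBilin F F)} => finrank F Q.1) (n / 2 + 1)]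
  · refine Finset.sum_congr rfl fun l _ => ?_
    rw [← card_isotropic_subspaces h2]
    congr 2
    exact Nat.card_congr ((Equiv.subtypeSubtypeEquivSubtypeInter _
      (fun Q : Submodule F (Fin n → F) => finrank F Q = l)).trans
      (Equiv.subtypeEquivRight fun Q => and_comm))
  · intro Q
    have := two_mul_finrank_le Q.2
    omega

theorem sum_subspaces_le {V : Type*} [AddCommGroup V] [Module F V] [Finite V]
    (T : Submodule F V) [Fintype {W : Submodule F V // W ≤ T}] (g : ℕ → ℚ) :
    ∑ W : {W : Submodule F V // W ≤ T}, g (finrank F W.1) =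
      ∑ k ∈ Finset.range (finrank F T + 1), gaussBinom (Nat.card F) (finrank F T) k * g k := by
  rw [sum_comp_eq_sum_card_mul (fun W : {W : Submodule F V // W ≤ T} => finrank F W.1)
    (finrank F T + 1)]
  · refine Finset.sum_congr rfl fun k hk => ?_
    rw [← card_subspaces_le T k (Nat.lt_succ_iff.1 (Finset.mem_range.1 hk))]
    congr 2
    exact Nat.card_congr ((Equiv.subtypeSubtypeEquivSubtypeInter _
      (fun W : Submodule F V => finrank F W = k)).trans
      (Equiv.subtypeEquivRight fun W => and_comm))
  · exact fun W => Nat.lt_succ_iff.2 (Submodule.finrank_mono W.2)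

end SelfOrthogonal

/-! ### Assembly of the enumeration and of the existence criterion. -/

section Enumeration

variable {R : Type*} [CommRing R] [IsLocalRing R] [Finite R] {γ : R}
  (h : IsUniformizer γ)
include h

/-- Each self-dual code has exactly one type, and the number of codes of a type depends only on the
dimensions of T₀ and Q. The sum over T therefore contributes the constant factor σ(2n, n). -/
theorem card_isSelfDual (h2 : (2 : ResidueField R) ≠ 0) (n N : ℕ) :
    (Nat.card {C : Code R γ 2 (2 * n) N // IsSelfDual h.cube C} : ℚ) =
      ∑ k ∈ Finset.range (n + 1), ∑ l ∈ Finset.range (N / 2 + 1),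
        sigma (ResidueField R) (2 * n) n * sigma (ResidueField R) N l *
          gaussBinom (Nat.card (ResidueField R)) n k *
          (Nat.card (ResidueField R) : ℚ) ^
            (k * (n + N - 1) + l * (2 * n - 2 * k + l - 1) / 2) := by
  classical
  have := Fintype.ofFinite (ResidueField R)
  have (m : ℕ) : Finite (Submodule (ResidueField R) (Fin m → ResidueField R)) :=
    Finite.of_injective _ SetLike.coe_injective
  have : Finite (Code R γ 2 (2 * n) N) := Finite.of_injective _ SetLike.coe_injective
  let TT := {T : Submodule (ResidueField R) (Fin (2 * n) → ResidueField R) //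
    T = T.orthogonalBilin (dotProductBilin _ _)}
  let QQ := {Q : Submodule (ResidueField R) (Fin N → ResidueField R) //
    Q ≤ Q.orthogonalBilin (dotProductBilin _ _)}
  let SS (T : TT) := {T₀ : Submodule (ResidueField R) (Fin (2 * n) → ResidueField R) // T₀ ≤ T.1}
  have : Fintype TT := Fintype.ofFinite _
  have : Fintype QQ := Fintype.ofFinite _
  have (T : TT) : Fintype (SS T) := Fintype.ofFinite _
  let f : (Σ p : (Σ T : TT, SS T × QQ),
      {C : Code R γ 2 (2 * n) N // HasType h p.1.1 p.2.1.1 p.2.2.1 C}) →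
      {C : Code R γ 2 (2 * n) N // IsSelfDual h.cube C} := fun x => ⟨x.2.1, x.2.2.1⟩
  have hf : Function.Bijective f := by
    constructor
    · rintro ⟨⟨⟨T, hT⟩, ⟨T₀, hT₀⟩, ⟨Q, hQ⟩⟩, ⟨C, hC⟩⟩
        ⟨⟨⟨T', hT'⟩, ⟨T₀', hT₀'⟩, ⟨Q', hQ'⟩⟩, ⟨C', hC'⟩⟩ hff
      obtain rfl : C = C' := congrArg Subtype.val hff
      obtain ⟨-, h1, h2, h3⟩ := id hC
      obtain ⟨-, h1', h2', h3'⟩ := id hC'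
      dsimp only at h1 h2 h3 h1' h2' h3'
      obtain rfl := h1.symm.trans h1'
      obtain rfl := h2.symm.trans h2'
      obtain rfl := h3.symm.trans h3'
      rfl
    · rintro ⟨C, hC⟩
      exact ⟨⟨⟨⟨torCode C, torCode_eq_orthogonal h hC⟩, ⟨resCode C, resCode_le_torCode C⟩,
        ⟨resCode₂ h C, resCode₂_le_orthogonal h hC⟩⟩, ⟨C, hC, rfl, rfl, rfl⟩⟩, rfl⟩
  rw [← Nat.card_congr (Equiv.ofBijective f hf), Nat.card_sigma, Fintype.sum_sigma, Nat.cast_sum]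
  have hT (T : TT) : ((∑ x : SS T × QQ,
      Nat.card {C : Code R γ 2 (2 * n) N // HasType h T.1 x.1.1 x.2.1 C} : ℕ) : ℚ) =
      ∑ k ∈ Finset.range (n + 1), gaussBinom (Nat.card (ResidueField R)) n k *
        ∑ l ∈ Finset.range (N / 2 + 1), sigma (ResidueField R) N l *
          (Nat.card (ResidueField R) : ℚ) ^
            (k * (n + N - 1) + l * (2 * n - 2 * k + l - 1) / 2) := by
    rw [Fintype.sum_prod_type, Nat.cast_sum]
    have hfin : finrank (ResidueField R) T.1 = n := ((eq_orthogonal_iff T.1).1 T.2).1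
    have h1 (T₀ : SS T) : ((∑ Q : QQ, Nat.card {C : Code R γ 2 (2 * n) N //
        HasType h T.1 T₀.1 Q.1 C} : ℕ) : ℚ) = ∑ l ∈ Finset.range (N / 2 + 1),
        sigma (ResidueField R) N l * (Nat.card (ResidueField R) : ℚ) ^
          (finrank (ResidueField R) T₀.1 * (n + N - 1) +
            l * (2 * n - 2 * finrank (ResidueField R) T₀.1 + l - 1) / 2) := by
      rw [← sum_isotropic h2 (fun l => (Nat.card (ResidueField R) : ℚ) ^
          (finrank (ResidueField R) T₀.1 * (n + N - 1) +
            l * (2 * n - 2 * finrank (ResidueField R) T₀.1 + l - 1) / 2)), Nat.cast_sum]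
      refine Finset.sum_congr rfl fun Q _ => ?_
      rw [card_hasType h h2 T.2 T₀.2 Q.2 rfl rfl, Nat.cast_pow]
    simp_rw [h1]
    have := sum_subspaces_le T.1 (fun k => ∑ l ∈ Finset.range (N / 2 + 1),
      sigma (ResidueField R) N l * (Nat.card (ResidueField R) : ℚ) ^
            (k * (n + N - 1) + l * (2 * n - 2 * k + l - 1) / 2))
    rw [hfin] at this
    exact this
  rw [Finset.sum_congr rfl fun T _ => hT T, Finset.sum_const, nsmul_eq_mul, Finset.card_univ,
    ← Nat.card_eq_fintype_card, card_eq_orthogonal h2, Finset.mul_sum]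
  refine Finset.sum_congr rfl fun k _ => ?_
  rw [Finset.mul_sum, Finset.mul_sum]
  refine Finset.sum_congr rfl fun l _ => ?_
  ring

theorem exists_isSelfDual_iff (h2 : (2 : ResidueField R) ≠ 0) (N₁ N₂ : ℕ) (hN₁ : 0 < N₁) :
    (∃ C : Code R γ 2 N₁ N₂, IsSelfDual h.cube C) ↔
      Even N₁ ∧ IsSquare ((-1 : ResidueField R) ^ (N₁ / 2)) := by
  have := Fintype.ofFinite (ResidueField R)
  have (m : ℕ) : Finite (Submodule (ResidueField R) (Fin m → ResidueField R)) :=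
    Finite.of_injective _ SetLike.coe_injective
  constructor
  · rintro ⟨C, hC⟩
    have hT := torCode_eq_orthogonal h hC
    have heven : Even N₁ := ⟨finrank _ (torCode C), by
      rw [← two_mul]; exact (two_mul_finrank_of_eq_orthogonal hT).symm⟩
    refine ⟨heven, ?_⟩
    by_contra hsq
    obtain ⟨n, rfl⟩ := heven.two_dvd
    have h0 := sigma_half_eq_zero heven hN₁ hsq
    rw [Nat.mul_div_cancel_left _ two_pos, ← card_eq_orthogonal h2, Nat.cast_eq_zero] at h0
    have : Nonempty {T : Submodule (ResidueField R) (Fin (2 * n) → ResidueField R) //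
      T = T.orthogonalBilin (dotProductBilin _ _)} := ⟨⟨_, hT⟩⟩
    exact Nat.card_pos.ne' h0
  · rintro ⟨heven, hsq⟩
    obtain ⟨n, rfl⟩ := heven.two_dvd
    have h0 := sigma_half_ne_zero heven hsq
    rw [Nat.mul_div_cancel_left _ two_pos, ← card_eq_orthogonal h2, Nat.cast_ne_zero] at h0
    obtain ⟨T, hT⟩ := (Nat.card_ne_zero.1 h0).1
    exact ⟨_, isSelfDual_baseCode h hT⟩

end Enumeration

end MixedCode

end

theorem theorem4p8 {R : Type*} [CommRing R] [IsLocalRing R] [Finite R]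
    (hchain : MixedCode.IsChainRing R) (hodd : Odd (ringChar R))
    (γ : R) (hγ : IsLocalRing.maximalIdeal R = Ideal.span {γ})
    (hγ3 : γ ^ 3 = 0) (hγ2 : γ ^ 2 ≠ 0)
    (N₁ N₂ : ℕ) (hN₁ : 0 < N₁) (hN₂ : 0 < N₂) :
    ((∃ C : MixedCode.Code R γ 2 N₁ N₂, MixedCode.IsSelfDual hγ3 C) ↔
      Even N₁ ∧ IsSquare ((-1 : IsLocalRing.ResidueField R) ^ (N₁ / 2))) ∧
    (Even N₁ → IsSquare ((-1 : IsLocalRing.ResidueField R) ^ (N₁ / 2)) →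
      (Nat.card {C : MixedCode.Code R γ 2 N₁ N₂ // MixedCode.IsSelfDual hγ3 C} : ℚ) =
        ∑ k₀ ∈ Finset.range (N₁ / 2 + 1), ∑ ℓ₀ ∈ Finset.range (N₂ / 2 + 1),
          MixedCode.sigma (IsLocalRing.ResidueField R) N₁ (N₁ / 2) *
          MixedCode.sigma (IsLocalRing.ResidueField R) N₂ ℓ₀ *
          MixedCode.gaussBinom (Nat.card (IsLocalRing.ResidueField R)) (N₁ / 2) k₀ *
          (Nat.card (IsLocalRing.ResidueField R) : ℚ) ^
            (k₀ * (N₁ / 2 + N₂ - 1) + ℓ₀ * (N₁ - 2 * k₀ + ℓ₀ - 1) / 2)) := by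
  have h : MixedCode.IsUniformizer γ := ⟨hγ, hγ3, hγ2⟩
  have h2 := MixedCode.residue_two_ne_zero hγ hγ3 hodd
  refine ⟨MixedCode.exists_isSelfDual_iff h h2 N₁ N₂ hN₁, fun heven _ => ?_⟩
  obtain ⟨n, rfl⟩ := heven.two_dvd
  rw [Nat.mul_div_cancel_left _ two_pos]
  exact MixedCode.card_isSelfDual h h2 n N₂
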